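/- **Setting.** Let $(V,E)$ be a finite directed graph with $n=|V|\ge 1$, equipped with one of two diffusion models. In the Independent Cascade model each edge $(u,v)$ has a probability $p_{u}(v)\in[0,1]$, and a vertex $u$ that becomes active has one independent chance to activate $v$. In the Linear Threshold model the edges have weights $w_{u,v}\ge 0$ whose sum over the edges entering any vertex is at most $1$, the thresholds $\tau_v$ are independent and uniform on $[0,1]$, and $v$ becomes active once $\sum_{u\text{ active},\,(u,v)\in E}w_{u,v}\ge\tau_v$. Let $\sigma(S)$ be the expected number of vertices finally active when the process is started from $S$, and $OPT=\max_{|S|\le k}\sigma(S)$. **Samples.** A random reverse reachable (RRR) set is the set of vertices from which there is a path to a uniformly random root $u\in V$ in a random subgraph $g$. In the IC model $g$ keeps each edge independently with its probability. In the LT model each vertex $v$ independently keeps at most one incoming edge, the edge $(u,v)$ with probability $w_{u,v}$. Given $\theta$ independent RRR sets $R_1,\dots,R_\theta$, let $\mathcal S(v)=\{i: v\in R_i\}$ and $C(S)=\bigl|\bigcup_{v\in S}\mathcal S(v)\bigr|$. **Algorithm** (GreediRIS with truncated greedy and streaming aggregation; parameters $k\ge1$, $m\ge 1$ local machines, $0\le\alpha\le1$,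 $0<\delta<\tfrac12$). Each vertex is assigned independently and uniformly to one of the $m$ machines. Each machine $p$ runs the greedy algorithm for $C$ on its vertices, with ties broken by a fixed order of $V$, and selects a list $S_p$ of $k$ vertices (all its vertices if it has fewer). It sends the first $\lceil\alpha k\rceil$ of them to the global machine, where the vertices arrive in an arbitrary order. Let $l$ and $u$ be given bounds with $0<l\le O\le u$, where $O$ is the maximum coverage by at most $k$ of the received vertices (no condition if $O=0$). For every integer $b\ge0$ with $l(1+\delta)^b\le u$ the global machine keeps a bucket $S_b$, initially empty. An arriving vertex $v$ is put into $S_b$ if $|S_b|<k$ and $C(S_b\cup\{v\})-C(S_b)\ge l(1+\delta)^b/(2k)$. The global solution $S_g$ is the bucket of largest coverage, and the output $S$ is a set of largest coverage among $S_g$ and the $S_p$. **Lemma.** Let $\varepsilon>0$, $\eta\in(0,1)$ and $\theta\ge\lambda^*/OPT$, where $$\lambda^*=\frac{2n}{\varepsilon^{2}}\left((1-\tfrac1e)\sqrt{\log\tfrac2\eta}+\sqrt{(1-\tfrac1e)\left(\log N+\log\tfrac2\eta\right)}\right)^2,\qquad N=\max_{0\le j\le k}\binom nj .$$ Put $$\rho=\frac{(1-e^{-\alpha})(1/2-\delta)}{(1-e^{-\alpha})+(1/2-\delta)}.$$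 Then $|S|\le k$ always, and the approximation ratio is $\rho-\varepsilon$ in expectation: $$\mathbb E[\sigma(S)]\ \ge\ (\rho-\varepsilon)\,OPT,$$ where the expectation is over the samples and the random assignment. Moreover, with probability at least $1-\eta$ over the samples, the expectation of $\sigma(S)$ over the random assignment alone, given the samples, is at least $(\rho-\varepsilon)\,OPT$. -/

import Mathlib

/-! ### Diffusion models and influence spread -/

/-- The two diffusion models. `IC p`: the edge `(u, v)` has activation probability `p u v`.
`LT w`: the edge `(u, v)` has weight `w u v`. -/
inductive DiffusionModel (V : Type*) where
  | IC (p : V → V → ℝ)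
  | LT (w : V → V → ℝ)

/-- A finite directed graph `(V, E)` together with a diffusion model on it. Only the values of `p`
and `w` on the edges matter. -/
structure Network (V : Type*) where
  E : Finset (V × V)
  model : DiffusionModel V

namespace Network

variable {V : Type*} [Fintype V] [DecidableEq V]

/-- In-neighbours of `v` in the set `g` of directed edges. -/
def inNbrs (g : Finset (V × V)) (v : V) : Finset V :=
  Finset.univ.filter fun u => (u, v) ∈ g

/-- Edge probabilities lie in `[0, 1]` (IC); weights are nonnegative and the weights entering a
vertex add up to at most `1` (LT). -/
def Valid (G : Network V) : Prop :=
  match G.model with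
  | .IC p => ∀ u v, (u, v) ∈ G.E → 0 ≤ p u v ∧ p u v ≤ 1
  | .LT w => (∀ u v, (u, v) ∈ G.E → 0 ≤ w u v) ∧ ∀ v, ∑ u ∈ inNbrs G.E v, w u v ≤ 1

/-- Probability that independent coin flips, one per edge, succeed exactly on `g ⊆ E`. -/
def icProb (E : Finset (V × V)) (p : V → V → ℝ) (g : Finset (V × V)) : ℝ :=
  ∏ e ∈ E, if e ∈ g then p e.1 e.2 else 1 - p e.1 e.2

/-- One diffusion step of IC. The coin of an edge is flipped once and for all, so that an edge
whose attempt failed has no second chance. -/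
def icStep (g : Finset (V × V)) (A : Finset V) : Finset V :=
  A ∪ Finset.univ.filter fun v => ∃ u ∈ A, (u, v) ∈ g

/-- One diffusion step of LT with thresholds `τ`. -/
noncomputable def ltStep (E : Finset (V × V)) (w : V → V → ℝ) (τ : V → ℝ) (A : Finset V) :
    Finset V :=
  A ∪ Finset.univ.filter fun v => τ v ≤ ∑ u ∈ A ∩ inNbrs E v, w u v

/-- Expected influence `σ(S)`: the expected number of vertices that are active when the process
started from `S` has stopped (it is stationary after at most `|V|` steps). For IC the expectation
is over the edge coins, for LT over independent thresholds, uniform on `[0, 1]`. -/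
noncomputable def influence (G : Network V) (S : Finset V) : ℝ :=
  match G.model with
  | .IC p => ∑ g ∈ G.E.powerset, icProb G.E p g * (((icStep g)^[Fintype.card V] S).card : ℝ)
  | .LT w => ∫ τ in Set.Icc (0 : V → ℝ) 1, (((ltStep G.E w τ)^[Fintype.card V] S).card : ℝ)

/-- `OPT`: the maximum influence of a seed set of at most `k` vertices. -/
noncomputable def opt (G : Network V) (k : ℕ) : ℝ :=
  (Finset.univ.filter fun S : Finset V => S.card ≤ k).sup' ⟨∅, by simp⟩ G.influence

/-! ### Random reverse reachable sets -/

/-- Probability that every vertex `v`, independently of the others, keeps exactly the incoming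
edges of `g`, when it keeps the single edge `(u, v) ∈ E` with probability `w u v` and no edge with
the remaining probability. -/
def ltProb (E : Finset (V × V)) (w : V → V → ℝ) (g : Finset (V × V)) : ℝ :=
  ∏ v, if (inNbrs g v).card = 0 then 1 - ∑ u ∈ inNbrs E v, w u v
    else if (inNbrs g v).card = 1 then ∑ u ∈ inNbrs g v, w u v
    else 0

/-- Law of the random subgraph `g ⊆ E` that is used to generate a sample. -/
def subgraphProb (G : Network V) (g : Finset (V × V)) : ℝ :=
  match G.model with
  | .IC p => icProb G.E p g
  | .LT w => ltProb G.E w g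

open Classical in
/-- `RRR_g(u)`: the vertices from which there is a path to `u` in `g`. -/
noncomputable def rrrSet (g : Finset (V × V)) (u : V) : Finset V :=
  Finset.univ.filter fun v => Relation.ReflTransGen (fun a b => (a, b) ∈ g) v u

/-- Probability that a sample (uniform root, random subgraph) is the vertex set `A`. -/
noncomputable def rrrProb (G : Network V) (A : Finset V) : ℝ :=
  ∑ u : V, ∑ g ∈ G.E.powerset,
    (Fintype.card V : ℝ)⁻¹ * G.subgraphProb g * (if rrrSet g u = A then 1 else 0)

/-- Probability that `θ` independent samples are `R 0, …, R (θ - 1)`. -/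
noncomputable def samplesProb (G : Network V) {θ : ℕ} (R : Fin θ → Finset V) : ℝ :=
  ∏ i, G.rrrProb (R i)

end Network

/-- The IMM sampling constant `λ*`, with
`λ* = 2 n ((1 - 1/e) a + b)² / ε²`, `a = √(log (2/η))`, `b = √((1 - 1/e) (log N + log (2/η)))`.
Here `N = max_{j ≤ k} (n choose j)`, which is `n choose k` as long as `k ≤ n / 2`. -/
noncomputable def lambdaStar (n k : ℕ) (ε η : ℝ) : ℝ :=
  2 * n * ((1 - Real.exp (-1)) * √(Real.log (2 / η))
    + √((1 - Real.exp (-1)) *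
        (Real.log (n.choose (min k (n / 2)) : ℝ) + Real.log (2 / η)))) ^ 2 / ε ^ 2

/-! ### Seed selection -/

namespace GreediRIS

section Cover

variable {V : Type*} [DecidableEq V] {θ : ℕ}

/-- The covering subset of `v`: the indices of the samples that contain `v`. -/
def coveringSet (R : Fin θ → Finset V) (v : V) : Finset (Fin θ) :=
  Finset.univ.filter fun i => v ∈ R i

/-- The indices covered by `S`. -/
def covered (R : Fin θ → Finset V) (S : Finset V) : Finset (Fin θ) :=
  S.biUnion (coveringSet R)

/-- The coverage `C(S)`. -/
def coverage (R : Fin θ → Finset V) (S : Finset V) : ℕ := (covered R S).card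

/-- The number of samples newly covered by `v`. -/
def gain (R : Fin θ → Finset V) (S : Finset V) (v : V) : ℕ :=
  (coveringSet R v \ covered R S).card

/-- The best possible coverage by at most `k` of the vertices in `W`. -/
def optCoverage (R : Fin θ → Finset V) (k : ℕ) (W : Finset V) : ℕ :=
  (W.powerset.filter fun S => S.card ≤ k).sup (coverage R)

/-- A candidate of largest coverage (the first one in case of ties). -/
def best (R : Fin θ → Finset V) (L : List (Finset V)) : Finset V :=
  (L.argmax (coverage R)).getD ∅

/-- The solution of one bucket with lower threshold `t`, after a pass over the stream `L`. -/
noncomputable def bucket (R : Fin θ → Finset V) (k : ℕ) (t : ℝ) (L : List V) : Finset V :=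
  L.foldl (fun S v => if S.card < k ∧ t / (2 * k) ≤ gain R S v then insert v S else S) ∅

/-- Streaming max-`k`-cover over the stream `L`, given a lower bound `l` and an upper bound `u` on
the optimal coverage: bucket `b` has lower threshold `l (1 + δ) ^ b`, for all `b` with
`l (1 + δ) ^ b ≤ u`; the solution of the best bucket is returned. -/
noncomputable def streamCover (R : Fin θ → Finset V) (k : ℕ) (δ l u : ℝ) (L : List V) :
    Finset V :=
  best R ((List.range (⌊Real.logb (1 + δ) (u / l)⌋₊ + 1)).map
    fun b => bucket R k (l * (1 + δ) ^ b) L)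

end Cover

section Algorithm

variable {V : Type*} [LinearOrder V] {θ : ℕ}

/-- Greedy max-`k`-cover over the vertices in `W`: `greedy R W k` lists the selected vertices in the
order of selection. Ties are broken by the smallest vertex; the selection ends early only if `W` is
exhausted. -/
def greedy (R : Fin θ → Finset V) (W : Finset V) : ℕ → List V
  | 0 => []
  | j + 1 =>
    let L := greedy R W j
    match ((W \ L.toFinset).sort (· ≤ ·)).argmax (gain R L.toFinset) with
    | none => L
    | some v => L ++ [v]

variable [Fintype V] {m : ℕ}

/-- The vertices assigned to machine `p` by the assignment `P`. -/
def part (P : V → Fin m) (p : Fin m) : Finset V := Finset.univ.filter fun v => P v = p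

/-- The `k` seeds computed by machine `p`. -/
def localSeeds (R : Fin θ → Finset V) (k : ℕ) (P : V → Fin m) (p : Fin m) : List V :=
  greedy R (part P p) k

/-- All seeds that are sent to the global machine: the top `α k` seeds (rounded up) of each
machine. -/
noncomputable def sentSeeds (R : Fin θ → Finset V) (k : ℕ) (α : ℝ) (P : V → Fin m) : List V :=
  (List.finRange m).flatMap fun p => (localSeeds R k P p).take ⌈α * k⌉₊

/-- The seed set returned when the seeds arrive at the global machine in the order `L`: the better
one of the global solution and the best local solution. -/
noncomputable def output (R : Fin θ → Finset V) (k : ℕ) (δ l u : ℝ) (P : V → Fin m)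
    (L : List V) : Finset V :=
  best R [streamCover R k δ l u L,
    best R ((List.finRange m).map fun p => (localSeeds R k P p).toFinset)]

end Algorithm

end GreediRIS

/-- Expectation of `f P` when each vertex is assigned independently and uniformly to one of the `m`
machines. -/
noncomputable def partitionExpectation {V : Type*} [Fintype V] [DecidableEq V] {m : ℕ}
    (f : (V → Fin m) → ℝ) : ℝ :=
  (∑ P : V → Fin m, f P) / (m : ℝ) ^ Fintype.card V

/-! The proof has two independent halves: a guarantee for max-`k`-cover that holds for every fixed
family of samples and averages over the assignment, and a transfer from coverage to influence by
concentration.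

Coverage. Fix a set `O` of at most `k` vertices and let `x = 1 - e^{-α}`, `y = 1/2 - δ`. A vertex of
`O` is rejected by machine `p` if the truncated greedy algorithm would not pick it when it is added
to the part of `p`; this does not depend on where the vertex itself is assigned. So a vertex is
selected on its own machine exactly as often as it is accepted by a uniformly random machine, and
the selected set together with the rejected set of a random machine covers, on average, at least
`C(O)` (`mul_coverage_le_sum`). Adding rejected vertices does not change a greedy run
(`greedy_union_eq`), so every local solution covers at least `x` times its rejected set; the
selected vertices reach the stream, so the global solution covers at least `y` times the selected
set. Balancing the two gives `xy / (x + y)`.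

Influence. In both models `σ(S) / n` is the probability that a sample meets `S`. For IC this is
reachability read backwards; for LT the threshold process is first replaced by live edges, one
vertex at a time (`sum_prod_mul_activationFinal_congr`). Hence `C(S)` is a sum of `θ` independent
indicators with mean `θσ(S)/n`. An exponential moment bound, summed over all sets of size at most
`k`, controls the data-dependent output from above. It is affine in `σ(S)`, hence compatible with a
coverage guarantee that holds only on average over the assignment. The sets number up to `2N²`
rather than `N`; the room for this comes from `2ρ ≤ 1 - 1/e` (`approximationRatio_le`,
`sub_mul_exp_sub_one_le`). -/

/-- Splitting off one coordinate of a sum over all functions. -/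
theorem Fintype.sum_sum_update {ι X M : Type*} [Fintype ι] [DecidableEq ι] [Fintype X]
    [Semiring M] (v : ι) (F : (ι → X) → M) :
    ∑ ω : ι → X, ∑ x, F (Function.update ω v x) = Fintype.card X * ∑ ω, F ω := by
  have h : ∑ z : (ι → X) × X, F (Function.update z.1 v z.2) = ∑ z : (ι → X) × X, F z.1 := by
    -- The map exchanges the coordinate `ω v` with the extra value `x`, so it is an involution.
    refine Finset.sum_nbij' (fun z => (Function.update z.1 v z.2, z.1 v))
      (fun z => (Function.update z.1 v z.2, z.1 v)) ?_ ?_ ?_ ?_ ?_ <;> simp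
  rw [Fintype.sum_prod_type, Fintype.sum_prod_type] at h
  rw [h]
  simp [Finset.mul_sum]

/-! ### Coverage as a monotone submodular function -/

namespace GreediRIS

section Cover

variable {V : Type*} [DecidableEq V] {θ : ℕ}

theorem mem_covered {R : Fin θ → Finset V} {S : Finset V} {i : Fin θ} :
    i ∈ covered R S ↔ ∃ v ∈ S, v ∈ R i := by
  simp [covered, coveringSet]

theorem covered_mono (R : Fin θ → Finset V) {S T : Finset V} (h : S ⊆ T) :
    covered R S ⊆ covered R T :=
  Finset.biUnion_subset_biUnion_of_subset_left _ h

theorem coverage_mono (R : Fin θ → Finset V) {S T : Finset V} (h : S ⊆ T) :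
    coverage R S ≤ coverage R T :=
  Finset.card_le_card (covered_mono R h)

theorem coverage_empty (R : Fin θ → Finset V) : coverage R ∅ = 0 := by
  simp [coverage, covered]

theorem coverage_eq_sum (R : Fin θ → Finset V) (S : Finset V) :
    coverage R S = ∑ i, if (R i ∩ S).Nonempty then 1 else 0 := by
  rw [coverage, Finset.sum_boole, Nat.cast_id]
  congr 1
  ext i
  rw [mem_covered]
  simp only [Finset.mem_filter, Finset.mem_univ, true_and, Finset.Nonempty, Finset.mem_inter]
  exact ⟨fun ⟨v, h, h'⟩ => ⟨v, h', h⟩, fun ⟨v, h, h'⟩ => ⟨v, h', h⟩⟩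

theorem coverage_insert (R : Fin θ → Finset V) (S : Finset V) (v : V) :
    coverage R (insert v S) = coverage R S + gain R S v := by
  rw [coverage, gain, coverage, covered, Finset.biUnion_insert, ← covered,
    ← Finset.card_sdiff_add_card, add_comm]

theorem gain_anti (R : Fin θ → Finset V) {S T : Finset V} (h : S ⊆ T) (v : V) :
    gain R T v ≤ gain R S v :=
  Finset.card_le_card (Finset.sdiff_subset_sdiff le_rfl (covered_mono R h))

theorem gain_eq_zero_of_mem (R : Fin θ → Finset V) {S : Finset V} {v : V} (h : v ∈ S) :
    gain R S v = 0 := by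
  have h1 := coverage_insert R S v
  rw [Finset.insert_eq_of_mem h] at h1
  omega

theorem coverage_le_add_sum_gain (R : Fin θ → Finset V) (S T : Finset V) :
    coverage R T ≤ coverage R S + ∑ v ∈ T, gain R S v := by
  have h : covered R T ⊆ covered R S ∪ T.biUnion fun v => coveringSet R v \ covered R S := by
    intro i hi
    by_cases h : i ∈ covered R S
    · exact Finset.mem_union_left _ h
    · obtain ⟨v, hv, hvi⟩ := Finset.mem_biUnion.1 hi
      exact Finset.mem_union_right _
        (Finset.mem_biUnion.2 ⟨v, hv, Finset.mem_sdiff.2 ⟨hvi, h⟩⟩)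
  calc coverage R T ≤ _ := Finset.card_le_card h
    _ ≤ _ := Finset.card_union_le _ _
    _ ≤ _ := Nat.add_le_add_left Finset.card_biUnion_le _

theorem coverage_le_optCoverage (R : Fin θ → Finset V) {k : ℕ} {W S : Finset V} (h : S ⊆ W)
    (hS : S.card ≤ k) : coverage R S ≤ optCoverage R k W :=
  Finset.le_sup (f := coverage R) (by simp [h, hS])

theorem exists_coverage_eq_optCoverage (R : Fin θ → Finset V) (k : ℕ) (W : Finset V) :
    ∃ S ⊆ W, S.card ≤ k ∧ coverage R S = optCoverage R k W := by
  obtain ⟨S, hS, h⟩ := Finset.exists_mem_eq_sup (W.powerset.filter fun S => S.card ≤ k)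
    ⟨∅, by simp⟩ (coverage R)
  simp only [Finset.mem_filter, Finset.mem_powerset] at hS
  exact ⟨S, hS.1, hS.2, h.symm⟩

theorem coverage_le_best (R : Fin θ → Finset V) {L : List (Finset V)} {A : Finset V}
    (h : A ∈ L) : coverage R A ≤ coverage R (best R L) := by
  rw [best]
  cases h' : L.argmax (coverage R) with
  | none => rw [List.argmax_eq_none] at h'; simp [h'] at h
  | some B => exact List.le_of_mem_argmax h h'

theorem best_induction (R : Fin θ → Finset V) {L : List (Finset V)} {p : Finset V → Prop}
    (h0 : p ∅) (h : ∀ A ∈ L, p A) : p (best R L) := by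
  rw [best]
  cases h' : L.argmax (coverage R) with
  | none => exact h0
  | some B => exact h B (List.argmax_mem h')

/-! ### Streaming aggregation -/

theorem bucket_concat (R : Fin θ → Finset V) (k : ℕ) (t : ℝ) (L : List V) (v : V) :
    bucket R k t (L ++ [v]) =
      if (bucket R k t L).card < k ∧ t / (2 * k) ≤ gain R (bucket R k t L) v then
        insert v (bucket R k t L) else bucket R k t L := by
  rw [bucket, List.foldl_append]
  rfl

theorem card_bucket_le (R : Fin θ → Finset V) (k : ℕ) (t : ℝ) (L : List V) :
    (bucket R k t L).card ≤ k := by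
  induction L using List.reverseRecOn with
  | nil => simp [bucket]
  | append_singleton L v ih =>
    rw [bucket_concat]
    split_ifs with h
    · exact (Finset.card_insert_le _ _).trans h.1
    · exact ih

theorem card_mul_le_coverage_bucket (R : Fin θ → Finset V) (k : ℕ) {t : ℝ} (ht : 0 ≤ t)
    (L : List V) :
    (bucket R k t L).card * (t / (2 * k)) ≤ coverage R (bucket R k t L) := by
  induction L using List.reverseRecOn with
  | nil => simp [bucket]
  | append_singleton L v ih =>
    rw [bucket_concat]
    split_ifs with h
    · rw [coverage_insert, Nat.cast_add]
      have h1 : ((insert v (bucket R k t L)).card : ℝ) ≤ (bucket R k t L).card + 1 := by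
        exact_mod_cast Finset.card_insert_le _ _
      have h2 : 0 ≤ t / (2 * k) := by positivity
      nlinarith [h.2]
    · exact ih

/-- The final bucket is not full, so capacity never caused a rejection. A rejected vertex had small
gain on arrival, and gains only decrease as the bucket grows; an accepted one has gain zero. -/
theorem gain_bucket_le (R : Fin θ → Finset V) (k : ℕ) {t : ℝ} (ht : 0 ≤ t) (L : List V)
    (hc : (bucket R k t L).card < k) :
    ∀ v ∈ L, (gain R (bucket R k t L) v : ℝ) ≤ t / (2 * k) := by
  induction L using List.reverseRecOn with
  | nil => simp
  | append_singleton L v ih =>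
    have hsub : bucket R k t L ⊆ bucket R k t (L ++ [v]) := by
      rw [bucket_concat]
      split_ifs
      · exact Finset.subset_insert _ _
      · exact subset_rfl
    have hc' := (Finset.card_le_card hsub).trans_lt hc
    intro x hx
    rcases List.mem_append.1 hx with hx | hx
    · exact (Nat.cast_le.2 (gain_anti R hsub x)).trans (ih hc' x hx)
    · obtain rfl : x = v := by simpa using hx
      by_cases h : t / (2 * k) ≤ gain R (bucket R k t L) x
      · rw [bucket_concat, if_pos ⟨hc', h⟩, gain_eq_zero_of_mem R (Finset.mem_insert_self _ _)]
        simp only [Nat.cast_zero]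
        positivity
      · exact (Nat.cast_le.2 (gain_anti R hsub x)).trans (not_le.1 h).le

/-- A full bucket collected `k` gains of at least `t / (2k)`. A bucket with room leaves every
streamed vertex with gain at most `t / (2k)`, so an optimal set adds at most `t / 2` to it. -/
theorem coverage_bucket_ge (R : Fin θ → Finset V) {k : ℕ} (hk : 1 ≤ k) {t : ℝ} (ht : 0 ≤ t)
    (L : List V) :
    min (t / 2) (optCoverage R k L.toFinset - t / 2) ≤ coverage R (bucket R k t L) := by
  have hk' : (0 : ℝ) < k := by exact_mod_cast hk
  have hkt : (k : ℝ) * (t / (2 * k)) = t / 2 := by field_simp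
  rcases (card_bucket_le R k t L).lt_or_eq with hc | hc
  · refine (min_le_right _ _).trans ?_
    obtain ⟨S, hS, hSk, hSo⟩ := exists_coverage_eq_optCoverage R k L.toFinset
    have h1 := coverage_le_add_sum_gain R (bucket R k t L) S
    have h2 : ∑ v ∈ S, (gain R (bucket R k t L) v : ℝ) ≤ S.card * (t / (2 * k)) := by
      rw [← nsmul_eq_mul]
      exact Finset.sum_le_card_nsmul _ _ _ fun v hv =>
        gain_bucket_le R k ht L hc v (List.mem_toFinset.1 (hS hv))
    have h3 : (S.card : ℝ) * (t / (2 * k)) ≤ k * (t / (2 * k)) := by gcongr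
    have h4 : (coverage R S : ℝ) ≤
        coverage R (bucket R k t L) + ∑ v ∈ S, (gain R (bucket R k t L) v : ℝ) := by
      exact_mod_cast h1
    rw [← hSo]
    linarith
  · have h1 := card_mul_le_coverage_bucket R k ht L
    rw [hc, hkt] at h1
    exact (min_le_left _ _).trans h1

theorem card_streamCover_le (R : Fin θ → Finset V) (k : ℕ) (δ l u : ℝ) (L : List V) :
    (streamCover R k δ l u L).card ≤ k := by
  refine best_induction R (p := fun S => S.card ≤ k) (by simp) fun A hA => ?_
  obtain ⟨b, -, rfl⟩ := List.mem_map.1 hA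
  exact card_bucket_le _ _ _ _

theorem coverage_streamCover_ge (R : Fin θ → Finset V) {k : ℕ} (hk : 1 ≤ k) {δ l u : ℝ}
    (hδ : 0 < δ) (L : List V)
    (hlu : 0 < optCoverage R k L.toFinset → 0 < l ∧ l ≤ optCoverage R k L.toFinset ∧
      (optCoverage R k L.toFinset : ℝ) ≤ u) :
    (1 / 2 - δ) * optCoverage R k L.toFinset ≤ coverage R (streamCover R k δ l u L) := by
  rcases Nat.eq_zero_or_pos (optCoverage R k L.toFinset) with h0 | hpos
  · simp [h0]
  obtain ⟨hl, hlO, hOu⟩ := hlu hpos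
  set O : ℝ := (optCoverage R k L.toFinset : ℝ) with hO
  have hOpos : 0 < O := Nat.cast_pos.2 hpos
  have h1δ : 1 < 1 + δ := by linarith
  -- The bucket whose threshold `t` is the right guess: `t ≤ O ≤ (1 + δ) t`. It exists because `O ≤
  -- u`. Then `O - t/2 ≥ O/2`, and `t/2 ≥ (1/2 - δ) O` since `(1/2 - δ)(1 + δ) ≤ 1/2`.
  set b := ⌊Real.logb (1 + δ) (O / l)⌋₊ with hb
  have hlog0 : 0 ≤ Real.logb (1 + δ) (O / l) :=
    Real.logb_nonneg h1δ ((one_le_div hl).2 hlO)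
  have hpow : Real.rpow (1 + δ) (Real.logb (1 + δ) (O / l)) = O / l :=
    Real.rpow_logb (by linarith) (by linarith) (by positivity)
  have hlow : l * (1 + δ) ^ b ≤ O := by
    have : (1 + δ) ^ b ≤ O / l := by
      rw [← hpow, ← Real.rpow_natCast]
      exact Real.rpow_le_rpow_of_exponent_le h1δ.le (Nat.floor_le hlog0)
    rw [le_div_iff₀ hl] at this
    linarith
  have hup : O ≤ l * (1 + δ) ^ b * (1 + δ) := by
    have : O / l ≤ (1 + δ) ^ (b + 1) := by
      rw [← hpow, ← Real.rpow_natCast]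
      refine Real.rpow_le_rpow_of_exponent_le h1δ.le ?_
      push_cast
      exact (Nat.lt_floor_add_one _).le
    rw [div_le_iff₀ hl, pow_succ] at this
    linarith
  have hmem : bucket R k (l * (1 + δ) ^ b) L ∈
      (List.range (⌊Real.logb (1 + δ) (u / l)⌋₊ + 1)).map
        fun b => bucket R k (l * (1 + δ) ^ b) L := by
    refine List.mem_map.2 ⟨b, List.mem_range.2 (Nat.lt_succ_of_le (Nat.floor_mono ?_)), rfl⟩
    exact Real.logb_le_logb_of_le h1δ (by positivity) (by gcongr)
  refine le_trans ?_ (Nat.cast_le.2 (coverage_le_best R hmem))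
  refine le_trans (le_min ?_ ?_) (coverage_bucket_ge R hk (by positivity) L)
  · nlinarith
  · rw [← hO]
    nlinarith

end Cover

/-! ### The greedy algorithm -/

section Greedy

variable {V : Type*} [LinearOrder V] {θ : ℕ}

/-- The vertex which greedy selects from `W` after the vertices in `S`. -/
def greedyChoice (R : Fin θ → Finset V) (W S : Finset V) : Option V :=
  ((W \ S).sort (· ≤ ·)).argmax (gain R S)

theorem greedy_succ (R : Fin θ → Finset V) (W : Finset V) (j : ℕ) :
    greedy R W (j + 1) = match greedyChoice R W (greedy R W j).toFinset with
      | none => greedy R W j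
      | some v => greedy R W j ++ [v] := rfl

/-- `List.argmax` breaks ties by position; in a sorted list this is the order of `V`, hence
consistent between different ground sets. -/
theorem idxOf_sort_le_iff {A : Finset V} {v w : V} (hv : v ∈ A) (hw : w ∈ A) :
    (A.sort (· ≤ ·)).idxOf v ≤ (A.sort (· ≤ ·)).idxOf w ↔ v ≤ w := by
  have hv' : (A.sort (· ≤ ·)).idxOf v < (A.sort (· ≤ ·)).length :=
    List.idxOf_lt_length_iff.2 ((Finset.mem_sort _).2 hv)
  have hw' : (A.sort (· ≤ ·)).idxOf w < (A.sort (· ≤ ·)).length :=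
    List.idxOf_lt_length_iff.2 ((Finset.mem_sort _).2 hw)
  have h := (Finset.sortedLT_sort A).strictMono_get.le_iff_le (a := ⟨_, hv'⟩) (b := ⟨_, hw'⟩)
  simpa using h.symm

theorem greedyChoice_eq_none {R : Fin θ → Finset V} {W S : Finset V} :
    greedyChoice R W S = none ↔ W ⊆ S := by
  rw [greedyChoice, List.argmax_eq_none, ← Finset.sdiff_eq_empty_iff_subset,
    ← List.toFinset_eq_empty_iff, Finset.sort_toFinset]

theorem greedyChoice_eq_some {R : Fin θ → Finset V} {W S : Finset V} {v : V} :
    greedyChoice R W S = some v ↔ v ∈ W \ S ∧ (∀ w ∈ W \ S, gain R S w ≤ gain R S v) ∧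
      ∀ w ∈ W \ S, gain R S v ≤ gain R S w → v ≤ w := by
  rw [greedyChoice, List.argmax_eq_some_iff]
  simp only [Finset.mem_sort]
  refine and_congr_right fun hv => and_congr_right fun _ =>
    forall₂_congr fun w hw => imp_congr_right fun _ => ?_
  exact idxOf_sort_le_iff hv hw

/-- A maximizer with a fixed tie-breaking order stays the maximizer when competitors are removed.
This consistency is what the random partition argument needs of greedy. -/
theorem greedyChoice_of_subset {R : Fin θ → Finset V} {W W' S : Finset V} {v : V}
    (h : greedyChoice R W S = some v) (hW : W' ⊆ W) (hv : v ∈ W') :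
    greedyChoice R W' S = some v := by
  rw [greedyChoice_eq_some] at h ⊢
  have hs := Finset.sdiff_subset_sdiff hW (le_refl S)
  exact ⟨Finset.mem_sdiff.2 ⟨hv, (Finset.mem_sdiff.1 h.1).2⟩, fun w hw => h.2.1 w (hs hw),
    fun w hw => h.2.2 w (hs hw)⟩

theorem greedy_prefix_succ (R : Fin θ → Finset V) (W : Finset V) (j : ℕ) :
    greedy R W j <+: greedy R W (j + 1) := by
  rw [greedy_succ]
  split <;> simp

theorem greedy_prefix (R : Fin θ → Finset V) (W : Finset V) {i j : ℕ} (h : i ≤ j) :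
    greedy R W i <+: greedy R W j := by
  induction j, h using Nat.le_induction with
  | base => exact List.prefix_rfl
  | succ j _ ih => exact ih.trans (greedy_prefix_succ R W j)

theorem length_greedy_le (R : Fin θ → Finset V) (W : Finset V) (j : ℕ) :
    (greedy R W j).length ≤ j := by
  induction j with
  | zero => simp [greedy]
  | succ j ih =>
    rw [greedy_succ]
    split
    · omega
    · simpa using ih

theorem length_greedy_of_not_subset (R : Fin θ → Finset V) (W : Finset V) (j : ℕ)
    (h : ¬ W ⊆ (greedy R W j).toFinset) : (greedy R W j).length = j := by
  induction j with
  | zero => simp [greedy]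
  | succ j ih =>
    have hsub : (greedy R W j).toFinset ⊆ (greedy R W (j + 1)).toFinset := fun x hx =>
      List.mem_toFinset.2 ((greedy_prefix_succ R W j).subset (List.mem_toFinset.1 hx))
    have h' := ih fun h' => h (h'.trans hsub)
    rw [greedy_succ]
    split
    · rename_i hx
      exact absurd ((greedyChoice_eq_none.1 hx).trans hsub) h
    · simpa using h'

theorem take_greedy (R : Fin θ → Finset V) (W : Finset V) {j k : ℕ} (h : j ≤ k) :
    (greedy R W k).take j = greedy R W j := by
  induction k, h using Nat.le_induction with
  | base => exact List.take_of_length_le (length_greedy_le R W j)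
  | succ k hk ih =>
    rw [greedy_succ]
    split
    · exact ih
    · rename_i x hx
      -- Greedy could still choose a vertex, so it never stopped early and the list has full length
      -- `k`.
      have hl := length_greedy_of_not_subset R W k fun hs => by
        rw [greedyChoice_eq_none.2 hs] at hx
        cases hx
      rw [List.take_append_of_le_length (by omega), ih]

/-- Greedy selects the same vertices when it is offered in addition vertices each of which it
would reject if it were offered alone. -/
theorem greedy_union_eq (R : Fin θ → Finset V) (W B : Finset V) (K : ℕ)
    (hB : ∀ v ∈ B, v ∉ greedy R (insert v W) K) :
    ∀ j ≤ K, greedy R (W ∪ B) j = greedy R W j := by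
  -- First one rejected vertex at a time: `v` is never chosen, so every choice from `insert v W` is
  -- already a choice from `W`.
  have single : ∀ v ∈ B, ∀ j ≤ K, greedy R (insert v W) j = greedy R W j := by
    intro v hv j hj
    induction j with
    | zero => rfl
    | succ j ih =>
      specialize ih (by omega)
      have hnot : greedyChoice R (insert v W) (greedy R W j).toFinset ≠ some v := fun h => by
        refine hB v hv ((greedy_prefix R _ hj).subset ?_)
        rw [greedy_succ, ih, h]
        simp
      have : greedyChoice R (insert v W) (greedy R W j).toFinset
          = greedyChoice R W (greedy R W j).toFinset := by
        cases h : greedyChoice R (insert v W) (greedy R W j).toFinset with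
        | none =>
          exact (greedyChoice_eq_none.2
            ((Finset.subset_insert _ _).trans (greedyChoice_eq_none.1 h))).symm
        | some x =>
          have hx := (Finset.mem_sdiff.1 (greedyChoice_eq_some.1 h).1).1
          rcases Finset.mem_insert.1 hx with rfl | hx
          · exact absurd h hnot
          · exact (greedyChoice_of_subset h (Finset.subset_insert _ _) hx).symm
      rw [greedy_succ, greedy_succ, ih, this]
  intro j hj
  induction j with
  | zero => rfl
  | succ j ih =>
    specialize ih (by omega)
    have : greedyChoice R (W ∪ B) (greedy R W j).toFinset
        = greedyChoice R W (greedy R W j).toFinset := by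
      cases h : greedyChoice R (W ∪ B) (greedy R W j).toFinset with
      | none =>
        exact (greedyChoice_eq_none.2
          (Finset.subset_union_left.trans (greedyChoice_eq_none.1 h))).symm
      | some x =>
        have hx := (Finset.mem_sdiff.1 (greedyChoice_eq_some.1 h).1).1
        rcases Finset.mem_union.1 hx with hx | hx
        · exact (greedyChoice_of_subset h Finset.subset_union_left hx).symm
        · exfalso
          -- A first choice `x` from `B` would also be the choice from `insert x W`, whose run
          -- agrees with that of `W` so far by `single`; but `x` is rejected there.
          refine hB x hx ((greedy_prefix R _ hj).subset ?_)
          have h' := greedyChoice_of_subset h (W' := insert x W)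
            (Finset.insert_subset (Finset.mem_union_right _ hx) Finset.subset_union_left)
            (Finset.mem_insert_self _ _)
          rw [greedy_succ, single x hx j (by omega), h']
          simp
    rw [greedy_succ, greedy_succ, ih, this]

/-- The vertices of `O` together gain at least `C(O) - C(A)`, so the best single gain is at least a
`k`-th of it. If greedy has exhausted `W`, then `O` is already included. -/
theorem coverage_greedy_succ_ge (R : Fin θ → Finset V) {W O : Finset V} {k : ℕ}
    (hO : O ⊆ W) (hOk : O.card ≤ k) (j : ℕ) :
    coverage R O + k * coverage R (greedy R W j).toFinset ≤
      coverage R (greedy R W j).toFinset + k * coverage R (greedy R W (j + 1)).toFinset := by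
  set A := (greedy R W j).toFinset with hA
  have h1 := coverage_le_add_sum_gain R A O
  rw [greedy_succ]
  split
  · rename_i h
    have := coverage_mono R (hO.trans (greedyChoice_eq_none.1 h))
    rw [← hA] at this ⊢
    omega
  · rename_i x hx
    rw [← hA] at hx
    have h2 : ∑ v ∈ O, gain R A v ≤ k * gain R A x := by
      refine (Finset.sum_le_card_nsmul _ _ (gain R A x) fun v hv => ?_).trans ?_
      · by_cases hvA : v ∈ A
        · rw [gain_eq_zero_of_mem R hvA]
          exact Nat.zero_le _
        · exact (greedyChoice_eq_some.1 hx).2.1 v (Finset.mem_sdiff.2 ⟨hO hv, hvA⟩)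
      · rw [smul_eq_mul]
        exact Nat.mul_le_mul_right _ hOk
    have h3 : (greedy R W j ++ [x]).toFinset = insert x A := by
      ext y
      simp [hA]
    rw [h3, coverage_insert, mul_add]
    omega

/-- Each step shrinks the gap to `C(O)` by the factor `1 - 1/k`, and `(1 - 1/k)^j ≤ e^{-j/k}`. Only
`|O| ≤ k` matters, so truncation at `j < k` is allowed. -/
theorem coverage_greedy_ge (R : Fin θ → Finset V) {W O : Finset V} {k : ℕ} (hk : 1 ≤ k)
    (hO : O ⊆ W) (hOk : O.card ≤ k) (j : ℕ) :
    (1 - Real.exp (-(j / k : ℝ))) * coverage R O ≤ coverage R (greedy R W j).toFinset := by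
  have hk' : (1 : ℝ) ≤ k := by exact_mod_cast hk
  have key : (coverage R O : ℝ) - coverage R (greedy R W j).toFinset
      ≤ (1 - 1 / k : ℝ) ^ j * coverage R O := by
    induction j with
    | zero => simp [greedy, coverage_empty]
    | succ j ih =>
      have h : (coverage R O : ℝ) + k * coverage R (greedy R W j).toFinset ≤
          coverage R (greedy R W j).toFinset + k * coverage R (greedy R W (j + 1)).toFinset := by
        exact_mod_cast coverage_greedy_succ_ge R hO hOk j
      have h0 : 0 ≤ (1 - 1 / k : ℝ) := by
        rw [sub_nonneg]
        exact (div_le_one (by linarith)).2 hk'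
      have h1 := mul_le_mul_of_nonneg_left ih h0
      rw [pow_succ']
      refine le_trans ?_ (h1.trans_eq (mul_assoc _ _ _).symm)
      have h2 : ((coverage R O : ℝ) - coverage R (greedy R W j).toFinset) / k ≤
          coverage R (greedy R W (j + 1)).toFinset - coverage R (greedy R W j).toFinset := by
        rw [div_le_iff₀ (by linarith)]
        nlinarith
      have h3 : (1 - 1 / k : ℝ) * (coverage R O - coverage R (greedy R W j).toFinset) =
          coverage R O - coverage R (greedy R W j).toFinset -
            (coverage R O - coverage R (greedy R W j).toFinset) / k := by ring
      rw [h3]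
      linarith
  have hexp : (1 - 1 / k : ℝ) ^ j ≤ Real.exp (-(j / k : ℝ)) := by
    have h0 : 0 ≤ (1 - 1 / k : ℝ) := by
      rw [sub_nonneg]
      exact (div_le_one (by linarith)).2 hk'
    calc (1 - 1 / k : ℝ) ^ j ≤ (Real.exp (-(1 / k : ℝ))) ^ j :=
          pow_le_pow_left₀ h0 (Real.one_sub_le_exp_neg _) j
      _ = _ := by rw [← Real.exp_nat_mul]; ring_nf
  have := mul_le_mul_of_nonneg_right hexp (Nat.cast_nonneg (α := ℝ) (coverage R O))
  linarith

end Greedy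

end GreediRIS

/-! ### Random assignment to machines -/

namespace GreediRIS

section Partition

variable {V : Type*} [LinearOrder V] [Fintype V] {θ m : ℕ}

/-- Whether machine `p` would accept `v` is independent of the machine to which `v` is assigned. -/
theorem insert_part_update (P : V → Fin m) (v : V) (p q : Fin m) :
    insert v (part (Function.update P v q) p) = insert v (part P p) := by
  ext w
  by_cases h : w = v <;> simp [part, h]

theorem insert_part_self (P : V → Fin m) (v : V) : insert v (part P (P v)) = part P (P v) := by
  simp [part]

/-- The optimal vertices which the truncated greedy algorithm on machine `p` would reject. -/
def rejected (R : Fin θ → Finset V) (K : ℕ) (O : Finset V) (P : V → Fin m) (p : Fin m) :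
    Finset V :=
  O.filter fun v => v ∉ greedy R (insert v (part P p)) K

/-- The optimal vertices which are selected by the truncated greedy algorithm on their machine. -/
def selected (R : Fin θ → Finset V) (K : ℕ) (O : Finset V) (P : V → Fin m) : Finset V :=
  O.filter fun v => v ∈ greedy R (part P (P v)) K

/-- Resample the machine of `v`: being selected on its own machine then averages acceptance over all
machines, and each machine either accepts or rejects `v`. -/
theorem sum_mem_selected_add_sum_mem_rejected (R : Fin θ → Finset V) (K : ℕ) {O : Finset V}
    {v : V} (hv : v ∈ O) :
    ∑ P : V → Fin m, ((∑ p, if v ∈ rejected R K O P p then 1 else 0)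
      + m * if v ∈ selected R K O P then 1 else 0) = m * m ^ Fintype.card V := by
  have h := Fintype.sum_sum_update v fun P : V → Fin m =>
    if v ∈ greedy R (insert v (part P (P v))) K then 1 else 0
  simp only [insert_part_update, Function.update_self, Fintype.card_fin, Nat.cast_id] at h
  rw [Finset.sum_add_distrib, ← Finset.mul_sum]
  simp only [selected, rejected, Finset.mem_filter, hv, true_and]
  simp only [insert_part_self] at h
  rw [← h, ← Finset.sum_add_distrib]
  simp only [← Finset.sum_add_distrib]
  have : ∀ (P : V → Fin m) p, ((if v ∉ greedy R (insert v (part P p)) K then 1 else 0)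
      + if v ∈ greedy R (insert v (part P p)) K then 1 else 0) = 1 := by
    intro P p
    split_ifs <;> simp_all
  simp only [this]
  simp [mul_comm]

/-- Coverage is a sum of indicators over samples. For a sample met by `O`, one vertex `v` of `O` in
it suffices, and the exact count for `v` is a lower bound. -/
theorem mul_coverage_le_sum (R : Fin θ → Finset V) (K : ℕ) (O : Finset V) :
    m * m ^ Fintype.card V * coverage R O ≤ ∑ P : V → Fin m,
      ((∑ p, coverage R (rejected R K O P p)) + m * coverage R (selected R K O P)) := by
  have hle : ∀ A : Finset V, ∀ i, ∀ v, v ∈ R i →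
      (if v ∈ A then 1 else 0) ≤ if (R i ∩ A).Nonempty then 1 else 0 := by
    intro A i v hv
    split_ifs with h1 h2
    · exact le_rfl
    · exact absurd ⟨v, Finset.mem_inter.2 ⟨hv, h1⟩⟩ h2
    · exact zero_le_one
    · exact le_rfl
  simp only [coverage_eq_sum]
  have hswap : ∑ P : V → Fin m, ((∑ p, ∑ i, if (R i ∩ rejected R K O P p).Nonempty then 1 else 0)
        + m * ∑ i, if (R i ∩ selected R K O P).Nonempty then 1 else 0)
      = ∑ i, ∑ P : V → Fin m, ((∑ p, if (R i ∩ rejected R K O P p).Nonempty then 1 else 0)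
        + m * if (R i ∩ selected R K O P).Nonempty then 1 else 0) := by
    rw [Finset.sum_comm]
    refine Finset.sum_congr rfl fun P _ => ?_
    rw [Finset.sum_add_distrib, Finset.mul_sum, Finset.sum_comm]
  rw [hswap, Finset.mul_sum]
  refine Finset.sum_le_sum fun i _ => ?_
  split_ifs with h
  · obtain ⟨v, hv⟩ := h
    rw [Finset.mem_inter] at hv
    rw [mul_one, ← sum_mem_selected_add_sum_mem_rejected R K hv.2]
    exact Finset.sum_le_sum fun P _ => add_le_add
      (Finset.sum_le_sum fun p _ => hle _ i v hv.1) (Nat.mul_le_mul_left _ (hle _ i v hv.1))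
  · simp

theorem ceil_mul_le {α : ℝ} (hα₁ : α ≤ 1) (k : ℕ) : ⌈α * k⌉₊ ≤ k := by
  refine Nat.ceil_le.2 ?_
  nlinarith [Nat.cast_nonneg (α := ℝ) k]

theorem card_output_le (R : Fin θ → Finset V) (k : ℕ) (δ l u : ℝ) (P : V → Fin m)
    (L : List V) : (output R k δ l u P L).card ≤ k := by
  refine best_induction R (p := fun S => S.card ≤ k) (by simp) fun A hA => ?_
  simp only [List.mem_cons, List.not_mem_nil, or_false] at hA
  rcases hA with rfl | rfl
  · exact card_streamCover_le _ _ _ _ _ _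
  · refine best_induction R (p := fun S => S.card ≤ k) (by simp) fun A hA => ?_
    obtain ⟨p, -, rfl⟩ := List.mem_map.1 hA
    exact (List.toFinset_card_le _).trans (length_greedy_le _ _ _)

theorem coverage_rejected_le_output (R : Fin θ → Finset V) {k : ℕ} (hk : 1 ≤ k) {α : ℝ}
    (hα₁ : α ≤ 1) (δ l u : ℝ) (P : V → Fin m) (L : List V) {O : Finset V}
    (hO : O.card ≤ k) (p : Fin m) :
    (1 - Real.exp (-α)) * coverage R (rejected R ⌈α * k⌉₊ O P p)
      ≤ coverage R (output R k δ l u P L) := by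
  have hk' : (0 : ℝ) < k := by exact_mod_cast hk
  set B := rejected R ⌈α * k⌉₊ O P p
  have h1 : coverage R (localSeeds R k P p).toFinset ≤ coverage R (output R k δ l u P L) :=
    (coverage_le_best R (L := (List.finRange m).map fun p => (localSeeds R k P p).toFinset)
      (List.mem_map.2 ⟨p, List.mem_finRange p, rfl⟩)).trans
      (coverage_le_best R (List.mem_cons_of_mem _ (List.mem_singleton_self _)))
  have h2 : coverage R (greedy R (part P p) ⌈α * k⌉₊).toFinset
      ≤ coverage R (localSeeds R k P p).toFinset :=
    coverage_mono R fun x hx => List.mem_toFinset.2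
      ((greedy_prefix R _ (ceil_mul_le hα₁ k)).subset (List.mem_toFinset.1 hx))
  -- The run is unchanged by the rejected vertices, so it can be compared with `B` although `B` need
  -- not lie on machine `p`.
  rw [← greedy_union_eq R (part P p) B ⌈α * k⌉₊
    (fun v hv => (Finset.mem_filter.1 hv).2) _ le_rfl] at h2
  have h3 := coverage_greedy_ge R hk (O := B) (W := part P p ∪ B) Finset.subset_union_right
    ((Finset.card_filter_le _ _).trans hO) ⌈α * k⌉₊
  refine le_trans (mul_le_mul_of_nonneg_right ?_ (Nat.cast_nonneg _))
    (h3.trans (Nat.cast_le.2 (h2.trans h1)))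
  gcongr
  rw [le_div_iff₀ hk']
  exact Nat.le_ceil _

theorem coverage_selected_le_output (R : Fin θ → Finset V) {k : ℕ} (hk : 1 ≤ k) {α δ l u : ℝ}
    (hα₁ : α ≤ 1) (hδ₀ : 0 < δ) (hδ₁ : δ < 1 / 2) (P : V → Fin m) {L : List V}
    (hL : L.Perm (sentSeeds R k α P))
    (hlu : 0 < optCoverage R k L.toFinset → 0 < l ∧ l ≤ optCoverage R k L.toFinset ∧
      (optCoverage R k L.toFinset : ℝ) ≤ u)
    {O : Finset V} (hO : O.card ≤ k) :
    (1 / 2 - δ) * coverage R (selected R ⌈α * k⌉₊ O P)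
      ≤ coverage R (output R k δ l u P L) := by
  have hsub : selected R ⌈α * k⌉₊ O P ⊆ L.toFinset := by
    intro v hv
    rw [List.mem_toFinset, hL.mem_iff, sentSeeds, List.mem_flatMap]
    refine ⟨P v, List.mem_finRange _, ?_⟩
    rw [localSeeds, take_greedy R _ (ceil_mul_le hα₁ k)]
    exact (Finset.mem_filter.1 hv).2
  have h1 := coverage_le_optCoverage R hsub ((Finset.card_filter_le _ _).trans hO)
  have h2 := coverage_streamCover_ge R hk hδ₀ L hlu
  have h3 : coverage R (streamCover R k δ l u L) ≤ coverage R (output R k δ l u P L) :=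
    coverage_le_best R List.mem_cons_self
  calc _ ≤ (1 / 2 - δ) * (optCoverage R k L.toFinset : ℝ) := by
        have : 0 ≤ 1 / 2 - δ := by linarith
        gcongr
    _ ≤ _ := h2
    _ ≤ _ := Nat.cast_le.2 h3

/-- The approximation guarantee of GreediRIS for max-`k`-cover, in expectation over the random
assignment of the vertices to the machines. -/
theorem coverage_le_partitionExpectation_output (R : Fin θ → Finset V) {k : ℕ} (hk : 1 ≤ k)
    (hm : 1 ≤ m) {α δ : ℝ} (hα₀ : 0 ≤ α) (hα₁ : α ≤ 1) (hδ₀ : 0 < δ) (hδ₁ : δ < 1 / 2)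
    (stream : (V → Fin m) → List V) (hstream : ∀ P, (stream P).Perm (sentSeeds R k α P))
    (l u : (V → Fin m) → ℝ)
    (hlu : ∀ P, 0 < optCoverage R k (stream P).toFinset →
      0 < l P ∧ l P ≤ optCoverage R k (stream P).toFinset ∧
        (optCoverage R k (stream P).toFinset : ℝ) ≤ u P)
    {O : Finset V} (hO : O.card ≤ k) :
    (1 - Real.exp (-α)) * (1 / 2 - δ) / ((1 - Real.exp (-α)) + (1 / 2 - δ)) * coverage R O ≤
      partitionExpectation fun P =>
        (coverage R (output R k δ (l P) (u P) P (stream P)) : ℝ) := by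
  set x := 1 - Real.exp (-α) with hx
  set y := 1 / 2 - δ with hy
  have hx0 : 0 ≤ x := by
    have := Real.exp_le_one_iff.2 (neg_nonpos.2 hα₀)
    linarith
  have hy0 : 0 < y := by linarith
  have hm' : (0 : ℝ) < m := by exact_mod_cast hm
  have hcount : (m * m ^ Fintype.card V * coverage R O : ℝ) ≤ ∑ P : V → Fin m,
      ((∑ p, (coverage R (rejected R ⌈α * k⌉₊ O P p) : ℝ))
        + m * coverage R (selected R ⌈α * k⌉₊ O P)) := by
    exact_mod_cast mul_coverage_le_sum R ⌈α * k⌉₊ O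
  have hP : ∀ P : V → Fin m, x * y * ((∑ p, (coverage R (rejected R ⌈α * k⌉₊ O P p) : ℝ))
        + m * coverage R (selected R ⌈α * k⌉₊ O P))
      ≤ m * (x + y) * coverage R (output R k δ (l P) (u P) P (stream P)) := by
    intro P
    have h1 : ∑ p, x * (coverage R (rejected R ⌈α * k⌉₊ O P p) : ℝ)
        ≤ ∑ _p : Fin m, (coverage R (output R k δ (l P) (u P) P (stream P)) : ℝ) :=
      Finset.sum_le_sum fun p _ => coverage_rejected_le_output R hk hα₁ δ _ _ P _ hO p
    rw [← Finset.mul_sum] at h1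
    simp only [Finset.sum_const, Finset.card_univ, Fintype.card_fin, nsmul_eq_mul] at h1
    have h2 := coverage_selected_le_output R hk hα₁ hδ₀ hδ₁ P (hstream P) (hlu P) hO
    rw [← hy] at h2
    -- The weights `y` and `x m` make both left sides multiples of `x y`; the right sides add up to
    -- `m (x + y)` times the output.
    have h1' := mul_le_mul_of_nonneg_left h1 hy0.le
    have h2' := mul_le_mul_of_nonneg_left h2 (mul_nonneg hx0 hm'.le)
    linarith
  have hsum := Finset.sum_le_sum fun P (_ : P ∈ Finset.univ) => hP P
  rw [← Finset.mul_sum, ← Finset.mul_sum] at hsum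
  have h3 := mul_le_mul_of_nonneg_left hcount (mul_nonneg hx0 hy0.le)
  have h4 := h3.trans hsum
  rw [partitionExpectation, le_div_iff₀ (by positivity), div_mul_eq_mul_div, div_mul_eq_mul_div,
    div_le_iff₀ (by positivity)]
  refine le_of_mul_le_mul_left ?_ hm'
  linarith

end Partition

end GreediRIS

/-! ### Monotone activation processes -/

namespace Network

section Activation

variable {V : Type*} [Fintype V] [DecidableEq V]

open Classical in
/-- One step of an activation process in which `v` becomes active as soon as the set of active
vertices belongs to `F v`. -/
noncomputable def activationStep (F : V → Set (Finset V)) (A : Finset V) : Finset V :=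
  A ∪ Finset.univ.filter fun v => A ∈ F v

/-- The final state of the activation process with seed set `S`. -/
noncomputable def activationFinal (F : V → Set (Finset V)) (S : Finset V) : Finset V :=
  (activationStep F)^[Fintype.card V] S

theorem subset_activationStep (F : V → Set (Finset V)) (A : Finset V) :
    A ⊆ activationStep F A :=
  Finset.subset_union_left

theorem mem_activationStep {F : V → Set (Finset V)} {A : Finset V} {v : V} :
    v ∈ activationStep F A ↔ v ∈ A ∨ A ∈ F v := by
  simp [activationStep]

theorem subset_activationFinal (F : V → Set (Finset V)) (S : Finset V) :
    S ⊆ activationFinal F S := by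
  rw [activationFinal]
  induction Fintype.card V with
  | zero => rfl
  | succ j ih =>
    rw [Function.iterate_succ_apply']
    exact ih.trans (subset_activationStep F _)

/-- Together with `mem_activationFinal_of_mem` this makes the final state the least set containing
`S` and closed under the rules, whatever the timing of activations. -/
theorem activationFinal_subset {F : V → Set (Finset V)} (hF : ∀ v, IsUpperSet (F v))
    {S B : Finset V} (hS : S ⊆ B) (hB : ∀ v, B ∈ F v → v ∈ B) : activationFinal F S ⊆ B := by
  rw [activationFinal]
  induction Fintype.card V with
  | zero => exact hS
  | succ j ih =>
    rw [Function.iterate_succ_apply']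
    intro v hv
    rcases mem_activationStep.1 hv with hv | hv
    · exact ih hv
    · exact hB v (hF v ih hv)

/-- Every step that is not stationary adds a vertex, so after `|V|` steps the process has stopped or
everything is active. -/
theorem activationStep_activationFinal (F : V → Set (Finset V)) (S : Finset V) :
    activationStep F (activationFinal F S) = activationFinal F S := by
  have h : ∀ j, activationStep F ((activationStep F)^[j] S) = (activationStep F)^[j] S ∨
      j ≤ ((activationStep F)^[j] S).card := by
    intro j
    induction j with
    | zero => exact Or.inr (Nat.zero_le _)
    | succ j ih =>
      rw [Function.iterate_succ_apply']
      by_cases h : activationStep F ((activationStep F)^[j] S) = (activationStep F)^[j] S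
      · exact Or.inl (congrArg _ h)
      · refine Or.inr (Nat.lt_of_le_of_lt (ih.resolve_left h) (Finset.card_lt_card ?_))
        exact (subset_activationStep F _).ssubset_of_ne (Ne.symm h)
  rcases h (Fintype.card V) with h | h
  · exact h
  · have hu : activationFinal F S = Finset.univ :=
      Finset.eq_univ_of_card _ (le_antisymm (Finset.card_le_univ _) h)
    rw [hu]
    exact Finset.univ_subset_iff.1 (subset_activationStep F _)

theorem mem_activationFinal_of_mem {F : V → Set (Finset V)} {S : Finset V} {v : V}
    (h : activationFinal F S ∈ F v) : v ∈ activationFinal F S := by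
  rw [← activationStep_activationFinal]
  exact mem_activationStep.2 (Or.inr h)

open Classical in
/-- The final state depends on the activation rule of the single vertex `v` only through the
question whether `v` becomes active in the final state which the other vertices reach without
`v`. -/
theorem activationFinal_eq_ite {F : V → Set (Finset V)} (hF : ∀ v, IsUpperSet (F v))
    (S : Finset V) (v : V) :
    activationFinal F S = if activationFinal (Function.update F v ∅) S ∈ F v then
      activationFinal (Function.update F v Set.univ) S
      else activationFinal (Function.update F v ∅) S := by
  have h0 : ∀ u, IsUpperSet (Function.update F v ∅ u) := by
    intro u
    by_cases h : u = v
    · subst h; simpa using isUpperSet_empty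
    · simpa [h] using hF u
  have h1 : ∀ u, IsUpperSet (Function.update F v Set.univ u) := by
    intro u
    by_cases h : u = v
    · subst h; simpa using isUpperSet_univ
    · simpa [h] using hF u
  have h0F : activationFinal (Function.update F v ∅) S ⊆ activationFinal F S := by
    refine activationFinal_subset h0 (subset_activationFinal _ _) fun u hu => ?_
    by_cases h : u = v
    · subst h; simp at hu
    · rw [Function.update_of_ne h] at hu
      exact mem_activationFinal_of_mem hu
  split_ifs with hv
  · apply subset_antisymm
    · refine activationFinal_subset hF (subset_activationFinal _ _) fun u hu => ?_
      refine mem_activationFinal_of_mem ?_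
      by_cases h : u = v
      · subst h; simp
      · rwa [Function.update_of_ne h]
    · refine activationFinal_subset h1 (subset_activationFinal _ _) fun u hu => ?_
      by_cases h : u = v
      · subst h
        exact mem_activationFinal_of_mem (hF _ h0F hv)
      · rw [Function.update_of_ne h] at hu
        exact mem_activationFinal_of_mem hu
  · refine subset_antisymm ?_ h0F
    refine activationFinal_subset hF (subset_activationFinal _ _) fun u hu => ?_
    by_cases h : u = v
    · subst h; exact absurd hu hv
    · refine mem_activationFinal_of_mem ?_
      rwa [Function.update_of_ne h]

/-- A monotone activation rule of a vertex: the upward closed family of the sets of active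
vertices which activate it. -/
abbrev ActivationRule (V : Type*) := {F : Set (Finset V) // IsUpperSet F}

noncomputable instance : Fintype (ActivationRule V) := Fintype.ofFinite _

open Classical in
theorem sum_update_mul_activationFinal_congr (ν : V → ActivationRule V → ℝ) (v : V)
    (κ κ' : ActivationRule V → ℝ) (htot : ∑ x, κ x = ∑ x, κ' x)
    (hact : ∀ A : Finset V, (∑ x, if A ∈ x.1 then κ x else 0) = ∑ x, if A ∈ x.1 then κ' x else 0)
    (S : Finset V) (φ : Finset V → ℝ) :
    ∑ ω : V → ActivationRule V, (∏ u, Function.update ν v κ u (ω u)) *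
        φ (activationFinal (fun u => (ω u).1) S) =
      ∑ ω : V → ActivationRule V, (∏ u, Function.update ν v κ' u (ω u)) *
        φ (activationFinal (fun u => (ω u).1) S) := by
  have hcard : (Fintype.card (ActivationRule V) : ℝ) ≠ 0 := by
    have : Nonempty (ActivationRule V) := ⟨⟨∅, isUpperSet_empty⟩⟩
    exact_mod_cast Fintype.card_ne_zero
  refine mul_left_cancel₀ hcard ?_
  rw [← Fintype.sum_sum_update v, ← Fintype.sum_sum_update v]
  refine Finset.sum_congr rfl fun ω _ => ?_
  set A0 := activationFinal (Function.update (fun u => (ω u).1) v ∅) S with hA0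
  set A1 := activationFinal (Function.update (fun u => (ω u).1) v Set.univ) S with hA1
  -- `A0` and `A1` ignore the rule of `v`, so the sum over this rule sees `κ` only through its total
  -- mass and the mass of the rules that `A0` triggers.
  have key : ∀ κ : ActivationRule V → ℝ,
      ∑ x, (∏ u, Function.update ν v κ u (Function.update ω v x u)) *
        φ (activationFinal (fun u => (Function.update ω v x u).1) S) =
      (∏ u ∈ Finset.univ.erase v, ν u (ω u)) *
        (φ A0 * ∑ x, κ x + (φ A1 - φ A0) * ∑ x, if A0 ∈ x.1 then κ x else 0) := by
    intro κ
    rw [Finset.mul_sum, Finset.mul_sum, ← Finset.sum_add_distrib, Finset.mul_sum]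
    refine Finset.sum_congr rfl fun x _ => ?_
    have hprod : ∏ u, Function.update ν v κ u (Function.update ω v x u) =
        κ x * ∏ u ∈ Finset.univ.erase v, ν u (ω u) := by
      rw [← Finset.mul_prod_erase _ _ (Finset.mem_univ v), Function.update_self,
        Function.update_self]
      congr 1
      refine Finset.prod_congr rfl fun u hu => ?_
      rw [Function.update_of_ne (Finset.ne_of_mem_erase hu),
        Function.update_of_ne (Finset.ne_of_mem_erase hu)]
    have hupd : ∀ Z : Set (Finset V),
        Function.update (fun u => (Function.update ω v x u).1) v Z =
          Function.update (fun u => (ω u).1) v Z := by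
      intro Z
      ext1 u
      by_cases h : u = v
      · subst h; simp
      · simp [h]
    rw [hprod, activationFinal_eq_ite (fun u => (Function.update ω v x u).2) S v, hupd, hupd,
      Function.update_self, ← hA0, ← hA1]
    split_ifs <;> ring
  rw [key, key, htot, hact]

open Classical in
/-- The law of the final state depends only on the probabilities with which the sets of active
vertices activate the single vertices. -/
theorem sum_prod_mul_activationFinal_congr (ν ν' : V → ActivationRule V → ℝ)
    (htot : ∀ v, ∑ x, ν v x = ∑ x, ν' v x)
    (hact : ∀ v, ∀ A : Finset V,
      (∑ x, if A ∈ x.1 then ν v x else 0) = ∑ x, if A ∈ x.1 then ν' v x else 0)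
    (S : Finset V) (φ : Finset V → ℝ) :
    ∑ ω : V → ActivationRule V, (∏ u, ν u (ω u)) * φ (activationFinal (fun u => (ω u).1) S) =
      ∑ ω : V → ActivationRule V, (∏ u, ν' u (ω u)) *
        φ (activationFinal (fun u => (ω u).1) S) := by
  -- Hybrid argument: the laws of the vertices in `T` have already been exchanged.
  have key : ∀ T : Finset V,
      ∑ ω : V → ActivationRule V, (∏ u, ν u (ω u)) * φ (activationFinal (fun u => (ω u).1) S) =
        ∑ ω : V → ActivationRule V, (∏ u, (if u ∈ T then ν' u else ν u) (ω u)) *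
          φ (activationFinal (fun u => (ω u).1) S) := by
    intro T
    induction T using Finset.induction_on with
    | empty => simp
    | insert v T hv ih =>
      rw [ih]
      have h1 : (fun u => if u ∈ T then ν' u else ν u) =
          Function.update (fun u => if u ∈ T then ν' u else ν u) v (ν v) := by
        ext1 u
        by_cases h : u = v
        · subst h; simp [hv]
        · simp [h]
      have h2 : (fun u => if u ∈ insert v T then ν' u else ν u) =
          Function.update (fun u => if u ∈ T then ν' u else ν u) v (ν' v) := by
        ext1 u
        by_cases h : u = v
        · subst h; simp
        · simp [h]
      have h3 := sum_update_mul_activationFinal_congr (fun u => if u ∈ T then ν' u else ν u) v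
        (ν v) (ν' v) (htot v) (hact v) S φ
      rw [← h1, ← h2] at h3
      exact h3
  simpa using key Finset.univ

/-! ### The linear threshold model -/

/-- The total weight of the edges in `E` from `A` to `v`. -/
def inWeight (E : Finset (V × V)) (w : V → V → ℝ) (v : V) (A : Finset V) : ℝ :=
  ∑ u ∈ A ∩ inNbrs E v, w u v

theorem inWeight_mono {E : Finset (V × V)} {w : V → V → ℝ}
    (hw : ∀ u v, (u, v) ∈ E → 0 ≤ w u v) (v : V) : Monotone (inWeight E w v) := by
  intro A B h
  refine Finset.sum_le_sum_of_subset_of_nonneg (Finset.inter_subset_inter_right h)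
    fun u hu _ => hw u v ?_
  simpa [inNbrs] using (Finset.mem_inter.1 hu).2

theorem inWeight_nonneg {E : Finset (V × V)} {w : V → V → ℝ}
    (hw : ∀ u v, (u, v) ∈ E → 0 ≤ w u v) (v : V) (A : Finset V) : 0 ≤ inWeight E w v A := by
  refine Finset.sum_nonneg fun u hu => hw u v ?_
  simpa [inNbrs] using (Finset.mem_inter.1 hu).2

theorem inWeight_univ (E : Finset (V × V)) (w : V → V → ℝ) (v : V) :
    inWeight E w v Finset.univ = ∑ u ∈ inNbrs E v, w u v := by
  simp [inWeight]

/-- The activation rule of a vertex in the linear threshold model. -/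
def thresholdRule {E : Finset (V × V)} {w : V → V → ℝ}
    (hw : ∀ u v, (u, v) ∈ E → 0 ≤ w u v) (v : V) (t : ℝ) : ActivationRule V :=
  ⟨{A | t ≤ inWeight E w v A}, fun _ _ h hA => le_trans hA (inWeight_mono hw v h)⟩

/-- The activation rule of a vertex which keeps the incoming edges from `c`. -/
def liveRule (c : Finset V) : ActivationRule V :=
  ⟨{A | (c ∩ A).Nonempty}, fun _ _ h hA => hA.mono (Finset.inter_subset_inter_left h)⟩

theorem ltStep_eq_activationStep {E : Finset (V × V)} {w : V → V → ℝ}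
    (hw : ∀ u v, (u, v) ∈ E → 0 ≤ w u v) (τ : V → ℝ) :
    ltStep E w τ = activationStep fun v => (thresholdRule hw v (τ v)).1 := by
  ext A v
  rw [mem_activationStep, ltStep, Finset.mem_union, Finset.mem_filter]
  simp [thresholdRule, inWeight]

theorem icStep_eq_activationStep (g : Finset (V × V)) :
    icStep g = activationStep fun v => (liveRule (inNbrs g v)).1 := by
  ext A v
  simp [icStep, activationStep, liveRule, inNbrs, Finset.Nonempty, and_comm]

end Activation

end Network

/-! ### Live-edge form of the linear threshold model -/

namespace Network

section LinearThreshold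

open MeasureTheory

variable {V : Type*} [Fintype V] [DecidableEq V]

/-- The law of the activation rule of `v` in the linear threshold model. -/
noncomputable def thresholdLaw {E : Finset (V × V)} {w : V → V → ℝ}
    (hw : ∀ u v, (u, v) ∈ E → 0 ≤ w u v) (v : V) (x : ActivationRule V) : ℝ :=
  volume.real (thresholdRule hw v ⁻¹' {x} ∩ Set.Icc 0 1)

theorem measurableSet_thresholdRule_preimage {E : Finset (V × V)} {w : V → V → ℝ}
    (hw : ∀ u v, (u, v) ∈ E → 0 ≤ w u v) (v : V) (s : Set (ActivationRule V)) :
    MeasurableSet (thresholdRule hw v ⁻¹' s) := by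
  have h : thresholdRule hw v ⁻¹' s = ⋃ x ∈ s, ⋂ A : Finset V,
      {t : ℝ | t ≤ inWeight E w v A ↔ A ∈ x.1} := by
    ext t
    simp only [Set.mem_preimage, Set.mem_iUnion, Set.mem_iInter, Set.mem_ofPred_eq, exists_prop]
    constructor
    · exact fun ht => ⟨_, ht, fun A => Iff.rfl⟩
    · rintro ⟨x, hx, h⟩
      have : thresholdRule hw v t = x := Subtype.ext (Set.ext h)
      rwa [this]
  rw [h]
  refine MeasurableSet.biUnion s.to_countable fun x _ => MeasurableSet.iInter fun A => ?_
  by_cases hA : A ∈ x.1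
  · simp only [hA, iff_true]
    exact measurableSet_Iic
  · simp only [hA, iff_false, not_le]
    exact measurableSet_Ioi

/-- There are finitely many rules, so the integral is a sum over the pushforward of a product
measure, which is again a product. -/
theorem integral_thresholdRule {E : Finset (V × V)} {w : V → V → ℝ}
    (hw : ∀ u v, (u, v) ∈ E → 0 ≤ w u v) (f : (V → ActivationRule V) → ℝ) :
    ∫ τ in Set.Icc (0 : V → ℝ) 1, f (fun v => thresholdRule hw v (τ v)) =
      ∑ ω : V → ActivationRule V, (∏ v, thresholdLaw hw v (ω v)) * f ω := by
  let _ : MeasurableSpace (ActivationRule V) := ⊤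
  have hmeas : ∀ v, Measurable (thresholdRule hw v) := fun v s _ =>
    measurableSet_thresholdRule_preimage hw v s
  have hvol : (volume : Measure (V → ℝ)).restrict (Set.Icc 0 1) =
      Measure.pi fun _ : V => (volume : Measure ℝ).restrict (Set.Icc 0 1) := by
    rw [volume_pi, ← Measure.restrict_pi_pi, Set.pi_univ_Icc]
    rfl
  rw [hvol, ← integral_map (φ := fun (τ : V → ℝ) v => thresholdRule hw v (τ v))
    (measurable_pi_lambda _ fun v => (hmeas v).comp (measurable_pi_apply v)).aemeasurable
    (measurable_of_finite f).aestronglyMeasurable,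
    Measure.pi_map_pi fun v => (hmeas v).aemeasurable, integral_fintype Integrable.of_finite]
  refine Finset.sum_congr rfl fun ω _ => ?_
  rw [smul_eq_mul]
  congr 1
  rw [measureReal_def, Measure.pi_singleton, ENNReal.toReal_prod]
  refine Finset.prod_congr rfl fun v _ => ?_
  rw [Measure.map_apply (hmeas v) (MeasurableSpace.measurableSet_top),
    Measure.restrict_apply (measurableSet_thresholdRule_preimage hw v _)]
  rfl

open Classical in
theorem sum_thresholdLaw {E : Finset (V × V)} {w : V → V → ℝ}
    (hw : ∀ u v, (u, v) ∈ E → 0 ≤ w u v) (v : V) (s : Set (ActivationRule V)) :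
    (∑ x, if x ∈ s then thresholdLaw hw v x else 0) =
      volume.real (thresholdRule hw v ⁻¹' s ∩ Set.Icc 0 1) := by
  have h : thresholdRule hw v ⁻¹' s ∩ Set.Icc 0 1 =
      ⋃ x ∈ Finset.univ.filter (· ∈ s), (thresholdRule hw v ⁻¹' {x} ∩ Set.Icc (0 : ℝ) 1) := by
    ext t
    simp only [Set.mem_inter_iff, Set.mem_preimage, Set.mem_iUnion, Finset.mem_filter,
      Finset.mem_univ, true_and, Set.mem_singleton_iff, exists_prop]
    exact ⟨fun h => ⟨_, h.1, rfl, h.2⟩, fun ⟨x, hx, h, ht⟩ => ⟨h ▸ hx, ht⟩⟩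
  rw [h, measureReal_biUnion_finset (h := fun x _ =>
    ne_top_of_le_ne_top (by simp) (measure_mono Set.inter_subset_right))]
  · rw [Finset.sum_filter]
    rfl
  · intro x _ y _ hxy
    refine Set.disjoint_left.2 fun t hx hy => hxy ?_
    exact hx.1.symm.trans hy.1
  · exact fun x _ => (measurableSet_thresholdRule_preimage hw v _).inter measurableSet_Icc

/-- Probability that `v` keeps the incoming edges from `c`, see `ltProb`. -/
def liveProb (E : Finset (V × V)) (w : V → V → ℝ) (v : V) (c : Finset V) : ℝ :=
  if c.card = 0 then 1 - ∑ u ∈ inNbrs E v, w u v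
  else if c.card = 1 then ∑ u ∈ c, w u v else 0

theorem sum_liveProb_mul (E : Finset (V × V)) (w : V → V → ℝ) (v : V) (φ : Finset V → ℝ) :
    ∑ c ∈ (inNbrs E v).powerset, liveProb E w v c * φ c =
      (1 - ∑ u ∈ inNbrs E v, w u v) * φ ∅ + ∑ u ∈ inNbrs E v, w u v * φ {u} := by
  have h : ∀ c ∈ (inNbrs E v).powerset, liveProb E w v c * φ c =
      (if c = ∅ then (1 - ∑ u ∈ inNbrs E v, w u v) * φ ∅ else 0) +
        ∑ u ∈ inNbrs E v, if c = {u} then w u v * φ {u} else 0 := by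
    intro c hc
    rw [liveProb]
    split_ifs with h0 h1 h2 h3 h4
    · subst h1
      simp [eq_comm (a := (∅ : Finset V))]
    · exact absurd (Finset.card_eq_zero.1 h0) h1
    · exact absurd (Finset.card_eq_zero.2 h3) h0
    · obtain ⟨u, rfl⟩ := Finset.card_eq_one.1 h2
      have hu : u ∈ inNbrs E v := by simpa using hc
      simp [hu]
    · exact absurd (Finset.card_eq_zero.2 h4) h0
    · rw [Finset.sum_eq_zero]
      · simp
      · rintro u -
        rw [if_neg]
        rintro rfl
        simp at h2
  rw [Finset.sum_congr rfl h, Finset.sum_add_distrib, Finset.sum_comm]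
  congr 1
  · simp
  · refine Finset.sum_congr rfl fun u hu => ?_
    rw [Finset.sum_ite_eq', if_pos (by simpa using hu)]

open Classical in
/-- The law of the activation rule of `v` in the live-edge model. -/
noncomputable def liveLaw (E : Finset (V × V)) (w : V → V → ℝ) (v : V) (x : ActivationRule V) :
    ℝ :=
  ∑ c ∈ (inNbrs E v).powerset, liveProb E w v c * if liveRule c = x then 1 else 0

theorem sum_thresholdLaw_eq {E : Finset (V × V)} {w : V → V → ℝ}
    (hw : ∀ u v, (u, v) ∈ E → 0 ≤ w u v) (v : V) :
    ∑ x, thresholdLaw hw v x = ∑ x, liveLaw E w v x := by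
  classical
  have h1 := sum_thresholdLaw hw v Set.univ
  simp only [Set.mem_univ, if_true, Set.preimage_univ, Set.univ_inter] at h1
  rw [h1]
  simp only [liveLaw]
  rw [Finset.sum_comm]
  simp only [← Finset.mul_sum, Finset.sum_ite_eq, Finset.mem_univ, if_true]
  rw [sum_liveProb_mul]
  simp

open Classical in
-- Both probabilities equal the weight from `A` into `v`: the length of the interval of thresholds
-- triggered by `A`, and the chance that the single kept edge starts in `A`. The bound `1` on the
-- weights keeps the interval inside `[0, 1]`.
theorem sum_mem_thresholdLaw_eq {E : Finset (V × V)} {w : V → V → ℝ}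
    (hw : ∀ u v, (u, v) ∈ E → 0 ≤ w u v) (hw1 : ∀ v, ∑ u ∈ inNbrs E v, w u v ≤ 1) (v : V)
    (A : Finset V) :
    (∑ x, if A ∈ x.1 then thresholdLaw hw v x else 0) =
      ∑ x, if A ∈ x.1 then liveLaw E w v x else 0 := by
  have h1 := sum_thresholdLaw hw v {x | A ∈ x.1}
  have h0 := inWeight_nonneg hw v A
  have h2 : inWeight E w v A ≤ 1 :=
    (inWeight_mono hw v (Finset.subset_univ A)).trans ((inWeight_univ E w v).trans_le (hw1 v))
  have hset : thresholdRule hw v ⁻¹' {x | A ∈ x.1} ∩ Set.Icc 0 1 =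
      Set.Icc 0 (inWeight E w v A) := by
    ext t
    simp only [thresholdRule, Set.mem_inter_iff, Set.mem_preimage, Set.mem_ofPred_eq, Set.mem_Icc]
    exact ⟨fun h => ⟨h.2.1, h.1⟩, fun h => ⟨h.2, h.1, h.2.trans h2⟩⟩
  rw [hset, Real.volume_real_Icc_of_le h0, sub_zero] at h1
  simp only [Set.mem_ofPred_eq] at h1
  rw [h1]
  have h3 : ∀ x : ActivationRule V, (if A ∈ x.1 then liveLaw E w v x else 0) =
      ∑ c ∈ (inNbrs E v).powerset, if liveRule c = x then
        liveProb E w v c * (if A ∈ (liveRule c).1 then 1 else 0) else 0 := by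
    intro x
    rw [liveLaw]
    split_ifs with hx
    · refine Finset.sum_congr rfl fun c _ => ?_
      split_ifs with h h'
      · rfl
      · subst h; exact absurd hx h'
      · simp
    · refine (Finset.sum_eq_zero fun c _ => ?_).symm
      split_ifs with h h'
      · subst h; exact absurd h' hx
      · simp
      · rfl
  simp only [h3]
  rw [Finset.sum_comm]
  simp only [Finset.sum_ite_eq, Finset.mem_univ, if_true]
  rw [sum_liveProb_mul E w v fun c => if A ∈ (liveRule c).1 then 1 else 0]
  have h4 : A ∉ (liveRule (∅ : Finset V)).1 := by simp [liveRule]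
  have h5 : ∀ u, A ∈ (liveRule ({u} : Finset V)).1 ↔ u ∈ A := by
    intro u
    simp [liveRule, Finset.Nonempty]
  simp only [h4, h5, if_false, mul_zero, zero_add, mul_ite, mul_one]
  rw [inWeight, ← Finset.sum_filter]
  congr 1
  ext u
  simp [and_comm]

open Classical in
theorem sum_prod_liveLaw (E : Finset (V × V)) (w : V → V → ℝ)
    (f : (V → ActivationRule V) → ℝ) :
    ∑ ω : V → ActivationRule V, (∏ v, liveLaw E w v (ω v)) * f ω =
      ∑ c ∈ Fintype.piFinset fun v => (inNbrs E v).powerset,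
        (∏ v, liveProb E w v (c v)) * f fun v => liveRule (c v) := by
  simp only [liveLaw, Finset.prod_univ_sum, Finset.sum_mul]
  rw [Finset.sum_comm]
  refine Finset.sum_congr rfl fun c _ => ?_
  simp only [Finset.prod_mul_distrib, Fintype.prod_boole]
  rw [Finset.sum_eq_single fun v => liveRule (c v)]
  · simp
  · intro ω _ hω
    rw [if_neg fun h => hω (funext fun v => (h v).symm)]
    simp
  · simp

/-- A subgraph is the same as an independent choice of in-neighbours at every vertex. -/
theorem sum_piFinset_inNbrs (E : Finset (V × V)) (F : (V → Finset V) → ℝ) :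
    ∑ c ∈ Fintype.piFinset fun v => (inNbrs E v).powerset, F c =
      ∑ g ∈ E.powerset, F (inNbrs g) := by
  refine Finset.sum_nbij' (fun c => Finset.univ.filter fun e => e.1 ∈ c e.2)
    (fun g => inNbrs g) ?_ ?_ ?_ ?_ ?_
  · intro c hc
    rw [Fintype.mem_piFinset] at hc
    refine Finset.mem_powerset.2 fun e he => ?_
    have := Finset.mem_powerset.1 (hc e.2) (Finset.mem_filter.1 he).2
    simpa [inNbrs] using this
  · intro g hg
    refine Fintype.mem_piFinset.2 fun v => Finset.mem_powerset.2 fun u hu => ?_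
    simp only [inNbrs, Finset.mem_filter, Finset.mem_univ, true_and] at hu ⊢
    exact Finset.mem_powerset.1 hg hu
  · intro c _
    ext v u
    simp [inNbrs]
  · intro g _
    ext e
    simp [inNbrs]
  · intro c _
    congr 1
    ext v u
    simp [inNbrs]

theorem ltProb_eq_prod_liveProb (E : Finset (V × V)) (w : V → V → ℝ) (g : Finset (V × V)) :
    ltProb E w g = ∏ v, liveProb E w v (inNbrs g v) := rfl

/-- The linear threshold process and the live-edge process have the same influence. -/
theorem integral_ltStep_eq {E : Finset (V × V)} {w : V → V → ℝ}
    (hw : ∀ u v, (u, v) ∈ E → 0 ≤ w u v) (hw1 : ∀ v, ∑ u ∈ inNbrs E v, w u v ≤ 1)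
    (S : Finset V) :
    ∫ τ in Set.Icc (0 : V → ℝ) 1, (((ltStep E w τ)^[Fintype.card V] S).card : ℝ) =
      ∑ g ∈ E.powerset, ltProb E w g * (((icStep g)^[Fintype.card V] S).card : ℝ) := by
  have h1 := integral_thresholdRule hw fun ω =>
    ((activationFinal (fun u => (ω u).1) S).card : ℝ)
  have h2 := sum_prod_mul_activationFinal_congr (thresholdLaw hw) (liveLaw E w)
    (sum_thresholdLaw_eq hw) (sum_mem_thresholdLaw_eq hw hw1) S fun A => (A.card : ℝ)
  have h3 := sum_prod_liveLaw E w fun ω => ((activationFinal (fun u => (ω u).1) S).card : ℝ)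
  have h4 := sum_piFinset_inNbrs E fun c => (∏ v, liveProb E w v (c v)) *
    ((activationFinal (fun u => (liveRule (c u)).1) S).card : ℝ)
  simp only [ltStep_eq_activationStep hw, icStep_eq_activationStep, ltProb_eq_prod_liveProb]
  exact h1.trans (h2.trans (h3.trans h4))

end LinearThreshold

end Network

/-! ### Reverse reachable samples and the law of coverage -/

namespace Network

section Samples

variable {V : Type*} [Fintype V] [DecidableEq V]

theorem influence_eq_sum {G : Network V} (hG : G.Valid) (S : Finset V) :
    G.influence S = ∑ g ∈ G.E.powerset,
      G.subgraphProb g * (((icStep g)^[Fintype.card V] S).card : ℝ) := by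
  obtain ⟨E, M⟩ := G
  cases M with
  | IC p => rfl
  | LT w => exact integral_ltStep_eq hG.1 hG.2 S

theorem subgraphProb_nonneg {G : Network V} (hG : G.Valid) {g : Finset (V × V)}
    (hg : g ⊆ G.E) : 0 ≤ G.subgraphProb g := by
  obtain ⟨E, M⟩ := G
  cases M with
  | IC p =>
    refine Finset.prod_nonneg fun e he => ?_
    have := hG e.1 e.2 he
    split_ifs <;> linarith
  | LT w =>
    refine Finset.prod_nonneg fun v _ => ?_
    have h2 := hG.2 v
    split_ifs
    · dsimp only at h2
      linarith
    · refine Finset.sum_nonneg fun u hu => hG.1 u v (hg ?_)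
      simpa [inNbrs] using hu
    · exact le_rfl

theorem sum_subgraphProb (G : Network V) : ∑ g ∈ G.E.powerset, G.subgraphProb g = 1 := by
  obtain ⟨E, M⟩ := G
  cases M with
  | IC p =>
    have h := Finset.prod_add (fun e : V × V => p e.1 e.2) (fun e => 1 - p e.1 e.2) E
    simp only [add_sub_cancel, Finset.prod_const_one] at h
    rw [h]
    refine Finset.sum_congr rfl fun g hg => ?_
    change ∏ e ∈ E, (if e ∈ g then p e.1 e.2 else 1 - p e.1 e.2) = _
    rw [Finset.prod_ite]
    congr 1
    · rw [Finset.filter_mem_eq_inter, Finset.inter_eq_right.2 (Finset.mem_powerset.1 hg)]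
    · rw [Finset.filter_notMem_eq_sdiff]
  | LT w =>
    have h := sum_piFinset_inNbrs E fun c => ∏ v, liveProb E w v (c v)
    refine h.symm.trans ?_
    rw [← Finset.prod_univ_sum]
    refine Finset.prod_eq_one fun v _ => ?_
    simpa using sum_liveProb_mul E w v fun _ => 1

/-- Reachability read backwards, on one fixed subgraph; it links influence to samples. -/
theorem mem_icStep_iterate (g : Finset (V × V)) (S : Finset V) (u : V) :
    u ∈ (icStep g)^[Fintype.card V] S ↔ (rrrSet g u ∩ S).Nonempty := by
  classical
  rw [icStep_eq_activationStep]
  change u ∈ activationFinal _ S ↔ _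
  set F : V → Set (Finset V) := fun v => (liveRule (inNbrs g v)).1 with hF
  have hFm : ∀ v A, A ∈ F v ↔ ∃ x ∈ A, (x, v) ∈ g := by
    intro v A
    simp [hF, liveRule, inNbrs, Finset.Nonempty, and_comm]
  constructor
  · have hsub : activationFinal F S ⊆ Finset.univ.filter fun u => (rrrSet g u ∩ S).Nonempty := by
      refine activationFinal_subset (fun v => (liveRule (inNbrs g v)).2) ?_ ?_
      · intro v hv
        refine Finset.mem_filter.2 ⟨Finset.mem_univ _, v, Finset.mem_inter.2 ⟨?_, hv⟩⟩
        simp [rrrSet, Relation.ReflTransGen.refl]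
      · intro v hv
        obtain ⟨x, hx, hxv⟩ := (hFm _ _).1 hv
        obtain ⟨s, hs⟩ := (Finset.mem_filter.1 hx).2
        rw [Finset.mem_inter] at hs
        refine Finset.mem_filter.2 ⟨Finset.mem_univ _, s, Finset.mem_inter.2 ⟨?_, hs.2⟩⟩
        have := hs.1
        simp only [rrrSet, Finset.mem_filter, Finset.mem_univ, true_and] at this ⊢
        exact this.tail hxv
    exact fun hu => (Finset.mem_filter.1 (hsub hu)).2
  · rintro ⟨s, hs⟩
    rw [Finset.mem_inter] at hs
    have h : Relation.ReflTransGen (fun a b => (a, b) ∈ g) s u := by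
      simpa [rrrSet] using hs.1
    induction h with
    | refl => exact subset_activationFinal _ _ hs.2
    | @tail b c hb hbc ih =>
      refine mem_activationFinal_of_mem ((hFm _ _).2 ⟨b, ih ⟨?_, hs.2⟩, hbc⟩)
      simpa [rrrSet] using hb

theorem sum_rrrProb_mul (G : Network V) (f : Finset V → ℝ) :
    ∑ A, G.rrrProb A * f A = (Fintype.card V : ℝ)⁻¹ *
      ∑ g ∈ G.E.powerset, G.subgraphProb g * ∑ u, f (rrrSet g u) := by
  simp only [rrrProb, Finset.sum_mul, Finset.mul_sum]
  rw [Finset.sum_comm]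
  rw [Finset.sum_comm (s := G.E.powerset)]
  refine Finset.sum_congr rfl fun u _ => ?_
  rw [Finset.sum_comm]
  refine Finset.sum_congr rfl fun g _ => ?_
  rw [Finset.sum_eq_single (rrrSet g u)]
  · rw [if_pos rfl]
    ring
  · intro A _ hA
    rw [if_neg (Ne.symm hA)]
    ring
  · simp

theorem rrrProb_nonneg {G : Network V} (hG : G.Valid) (A : Finset V) : 0 ≤ G.rrrProb A := by
  refine Finset.sum_nonneg fun u _ => Finset.sum_nonneg fun g hg => ?_
  have := subgraphProb_nonneg hG (Finset.mem_powerset.1 hg)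
  positivity

theorem sum_rrrProb [Nonempty V] (G : Network V) : ∑ A, G.rrrProb A = 1 := by
  have h := G.sum_rrrProb_mul fun _ => 1
  simp only [mul_one, Finset.sum_const, Finset.card_univ, nsmul_eq_mul] at h
  rw [h, ← Finset.sum_mul, sum_subgraphProb, one_mul, inv_mul_cancel₀]
  exact_mod_cast Fintype.card_ne_zero

/-- The influence of `S` is `|V|` times the probability that a sample meets `S`. -/
theorem sum_rrrProb_mul_inter {G : Network V} (hG : G.Valid) (S : Finset V) :
    ∑ A, G.rrrProb A * (if (A ∩ S).Nonempty then 1 else 0)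
      = G.influence S / Fintype.card V := by
  rw [sum_rrrProb_mul, influence_eq_sum hG, div_eq_inv_mul]
  congr 1
  refine Finset.sum_congr rfl fun g _ => ?_
  rw [Finset.sum_boole]
  congr 3
  ext u
  rw [mem_icStep_iterate]
  simp

theorem card_le_influence {G : Network V} (hG : G.Valid) (S : Finset V) :
    (S.card : ℝ) ≤ G.influence S := by
  rw [influence_eq_sum hG]
  calc (S.card : ℝ) = ∑ g ∈ G.E.powerset, G.subgraphProb g * (S.card : ℝ) := by
        rw [← Finset.sum_mul, sum_subgraphProb, one_mul]
    _ ≤ _ := by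
        refine Finset.sum_le_sum fun g hg => mul_le_mul_of_nonneg_left (Nat.cast_le.2 ?_)
          (subgraphProb_nonneg hG (Finset.mem_powerset.1 hg))
        refine Finset.card_le_card ?_
        rw [icStep_eq_activationStep]
        exact subset_activationFinal _ S

theorem exists_influence_eq_opt (G : Network V) (k : ℕ) :
    ∃ S : Finset V, S.card ≤ k ∧ G.influence S = G.opt k := by
  obtain ⟨S, hS, h⟩ := Finset.exists_mem_eq_sup'
    (s := Finset.univ.filter fun S : Finset V => S.card ≤ k) ⟨∅, by simp⟩ G.influence
  exact ⟨S, (Finset.mem_filter.1 hS).2, h.symm⟩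

theorem opt_pos [Nonempty V] {G : Network V} (hG : G.Valid) {k : ℕ} (hk : 1 ≤ k) :
    0 < G.opt k := by
  obtain ⟨v⟩ := ‹Nonempty V›
  have h1 := card_le_influence hG {v}
  have h2 : G.influence {v} ≤ G.opt k := Finset.le_sup' G.influence (by simpa using hk)
  simp only [Finset.card_singleton, Nat.cast_one] at h1
  linarith

theorem samplesProb_nonneg {G : Network V} (hG : G.Valid) {θ : ℕ} (R : Fin θ → Finset V) :
    0 ≤ G.samplesProb R :=
  Finset.prod_nonneg fun _ _ => rrrProb_nonneg hG _

theorem sum_samplesProb_mul_prod (G : Network V) {θ : ℕ} (f : Fin θ → Finset V → ℝ) :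
    ∑ R : Fin θ → Finset V, G.samplesProb R * ∏ i, f i (R i) =
      ∏ i, ∑ A, G.rrrProb A * f i A := by
  rw [Finset.prod_univ_sum, Fintype.piFinset_univ]
  simp only [samplesProb, Finset.prod_mul_distrib]

theorem sum_samplesProb [Nonempty V] (G : Network V) (θ : ℕ) :
    ∑ R : Fin θ → Finset V, G.samplesProb R = 1 := by
  have h := G.sum_samplesProb_mul_prod fun (_ : Fin θ) _ => 1
  simpa [sum_rrrProb] using h

theorem sum_samplesProb_mul_coverage [Nonempty V] {G : Network V} (hG : G.Valid) {θ : ℕ}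
    (S : Finset V) :
    ∑ R : Fin θ → Finset V, G.samplesProb R * GreediRIS.coverage R S =
      θ * (G.influence S / Fintype.card V) := by
  have h : ∀ i : Fin θ, ∑ R : Fin θ → Finset V,
      G.samplesProb R * (if (R i ∩ S).Nonempty then 1 else 0)
        = G.influence S / Fintype.card V := by
    intro i
    have h1 := G.sum_samplesProb_mul_prod fun j A =>
      if j = i then (if (A ∩ S).Nonempty then (1 : ℝ) else 0) else 1
    simp only [Finset.prod_ite_eq', Finset.mem_univ, if_true] at h1
    rw [h1, Finset.prod_eq_single i]
    · simp only [if_true]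
      exact sum_rrrProb_mul_inter hG S
    · intro j _ hj
      simp [hj, sum_rrrProb]
    · simp
  simp only [GreediRIS.coverage_eq_sum, Nat.cast_sum, Finset.mul_sum, Nat.cast_ite, Nat.cast_one,
    Nat.cast_zero]
  rw [Finset.sum_comm, Finset.sum_congr rfl fun i _ => h i]
  simp

/-- The moment generating function of the coverage of `S`. -/
theorem sum_samplesProb_mul_exp_coverage_le [Nonempty V] {G : Network V} (hG : G.Valid) {θ : ℕ}
    (S : Finset V) (s : ℝ) :
    ∑ R : Fin θ → Finset V, G.samplesProb R * Real.exp (s * GreediRIS.coverage R S) ≤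
      Real.exp (θ * (G.influence S / Fintype.card V) * (Real.exp s - 1)) := by
  have h := G.sum_samplesProb_mul_prod fun (_ : Fin θ) A =>
    Real.exp (s * if (A ∩ S).Nonempty then 1 else 0)
  have h1 : ∀ R : Fin θ → Finset V, Real.exp (s * GreediRIS.coverage R S) =
      ∏ i, Real.exp (s * if (R i ∩ S).Nonempty then 1 else 0) := by
    intro R
    rw [← Real.exp_sum, ← Finset.mul_sum, GreediRIS.coverage_eq_sum]
    simp
  simp only [h1, h, Finset.prod_const, Finset.card_univ, Fintype.card_fin]
  have h2 : ∑ A, G.rrrProb A * Real.exp (s * if (A ∩ S).Nonempty then 1 else 0) =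
      1 + G.influence S / Fintype.card V * (Real.exp s - 1) := by
    have h3 : ∑ A, G.rrrProb A * Real.exp (s * if (A ∩ S).Nonempty then 1 else 0) =
        ∑ A, (G.rrrProb A +
          G.rrrProb A * (if (A ∩ S).Nonempty then 1 else 0) * (Real.exp s - 1)) := by
      refine Finset.sum_congr rfl fun A _ => ?_
      split_ifs
      · rw [mul_one]
        ring
      · rw [mul_zero, Real.exp_zero]
        ring
    rw [h3, Finset.sum_add_distrib, ← Finset.sum_mul, G.sum_rrrProb, sum_rrrProb_mul_inter hG]
  have h0 : 0 ≤ ∑ A, G.rrrProb A * Real.exp (s * if (A ∩ S).Nonempty then 1 else 0) :=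
    Finset.sum_nonneg fun A _ => mul_nonneg (rrrProb_nonneg hG A) (Real.exp_pos _).le
  -- Compare factor by factor, using `1 + p (e^s - 1) ≤ exp (p (e^s - 1))`.
  rw [mul_assoc, Real.exp_nat_mul]
  refine pow_le_pow_left₀ h0 ?_ θ
  rw [h2, add_comm]
  exact Real.add_one_le_exp _

end Samples

end Network

/-! ### Counting and numerical estimates -/

theorem Nat.choose_le_choose_min_half {n j k : ℕ} (h : j ≤ k) :
    n.choose j ≤ n.choose (min k (n / 2)) := by
  rcases le_total k (n / 2) with hk | hk
  · rw [min_eq_left hk]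
    induction k, h using Nat.le_induction with
    | base => exact le_rfl
    | succ k hjk ih =>
      exact (ih (by omega)).trans (Nat.choose_le_succ_of_lt_half_left (by omega))
  · rw [min_eq_right hk]
    exact Nat.choose_le_middle j n

/-- At most `n + 1` sizes with at most `N` sets each, and `n ≤ N` because `k ≥ 1`. -/
theorem card_filter_card_le_le {V : Type*} [Fintype V] [DecidableEq V] [Nonempty V] {k : ℕ}
    (hk : 1 ≤ k) :
    (Finset.univ.filter fun S : Finset V => S.card ≤ k).card ≤
      2 * (Fintype.card V).choose (min k (Fintype.card V / 2)) ^ 2 := by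
  set n := Fintype.card V with hn
  set N := n.choose (min k (n / 2)) with hN
  have hn1 : 1 ≤ n := Fintype.card_pos
  have hnN : n ≤ N := by
    have := Nat.choose_le_choose_min_half (n := n) hk
    rwa [Nat.choose_one_right] at this
  have h1 : (Finset.univ.filter fun S : Finset V => S.card ≤ k) ⊆
      ((Finset.range (n + 1)).filter (· ≤ k)).biUnion fun j =>
        Finset.powersetCard j Finset.univ := by
    intro S hS
    refine Finset.mem_biUnion.2 ⟨S.card, ?_, ?_⟩
    · have := Finset.card_le_univ S
      simp only [Finset.mem_filter, Finset.mem_univ, true_and, Finset.mem_range] at hS ⊢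
      omega
    · simp [Finset.mem_powersetCard]
  calc _ ≤ _ := Finset.card_le_card h1
    _ ≤ ∑ j ∈ (Finset.range (n + 1)).filter (· ≤ k),
        (Finset.powersetCard j (Finset.univ : Finset V)).card := Finset.card_biUnion_le
    _ ≤ ((Finset.range (n + 1)).filter (· ≤ k)).card • N := by
        refine Finset.sum_le_card_nsmul _ _ _ fun j hj => ?_
        rw [Finset.card_powersetCard, Finset.card_univ]
        exact Nat.choose_le_choose_min_half (Finset.mem_filter.1 hj).2
    _ ≤ (n + 1) * N := by
        rw [smul_eq_mul]
        refine Nat.mul_le_mul_right _ ((Finset.card_filter_le _ _).trans ?_)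
        simp
    _ ≤ 2 * N ^ 2 := by nlinarith

theorem Real.exp_neg_le_quadratic {t : ℝ} (ht : 0 ≤ t) : Real.exp (-t) ≤ 1 - t + t ^ 2 / 2 := by
  have h1 := Real.quadratic_le_exp_of_nonneg ht
  have h2 : 0 ≤ 1 - t + t ^ 2 / 2 := by nlinarith [sq_nonneg (t - 1)]
  -- The product of the two quadratics is `1 + t⁴/4`.
  have h3 : 1 ≤ (1 - t + t ^ 2 / 2) * Real.exp t :=
    calc (1 : ℝ) ≤ (1 - t + t ^ 2 / 2) * (1 + t + t ^ 2 / 2) := by nlinarith [sq_nonneg (t ^ 2)]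
      _ ≤ _ := mul_le_mul_of_nonneg_left h1 h2
  rw [Real.exp_neg, inv_le_iff_one_le_mul₀ (Real.exp_pos t)]
  exact h3

theorem Real.one_sub_mul_exp_sub_le {s : ℝ} (h0 : 0 ≤ s) (h1 : s ≤ 1) :
    (1 - s) * (Real.exp s - 1 - s) ≤ s ^ 2 / 2 := by
  have h := Real.exp_bound' h0 h1 (n := 3) (by norm_num)
  simp only [Finset.sum_range_succ, Finset.sum_range_zero, Nat.factorial] at h
  norm_num at h
  have h2 : Real.exp s - 1 - s ≤ s ^ 2 / 2 + s ^ 3 * 2 / 9 := by linarith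
  have h3 := mul_le_mul_of_nonneg_left h2 (sub_nonneg.2 h1)
  have h4 : 0 ≤ s ^ 3 := by positivity
  have h5 : 0 ≤ s ^ 4 := by positivity
  nlinarith

/-- The numerical inequality behind the choice of the number of samples. -/
theorem sub_mul_exp_sub_one_le {κ a q ε ρ : ℝ} (hκ : 0 < κ) (ha : 0 ≤ a) (hq : 0 ≤ q)
    (hε : κ * a + q ≤ ε) (hρ : 2 * ρ ≤ κ) (hr : ε ≤ ρ) :
    (ρ - ε) * (Real.exp (2 * q / κ) - 1) ≤ 2 * q / κ * ρ * (1 - a) - q ^ 2 / κ := by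
  set s := 2 * q / κ with hs
  have hqs : q = κ * s / 2 := by rw [hs]; field_simp
  have hs0 : 0 ≤ s := by positivity
  have hqρ : q ≤ ρ := by nlinarith
  have hs1 : s ≤ 1 := by
    rw [hs, div_le_one hκ]
    linarith
  have h1 := Real.one_sub_mul_exp_sub_le hs0 hs1
  have h2 : 0 ≤ Real.exp s - 1 - s := by
    have := Real.add_one_le_exp s
    linarith
  -- From `ρ ≤ κ/2` and `ε ≥ q = κ s / 2`. The factor `1 - s` absorbs the higher terms of `e^s`.
  have h3 : ρ - ε ≤ κ / 2 * (1 - s) := by nlinarith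
  have h4 : (ρ - ε) * (Real.exp s - 1 - s) ≤ κ / 2 * (s ^ 2 / 2) := by
    calc _ ≤ κ / 2 * (1 - s) * (Real.exp s - 1 - s) := mul_le_mul_of_nonneg_right h3 h2
      _ = κ / 2 * ((1 - s) * (Real.exp s - 1 - s)) := by ring
      _ ≤ _ := mul_le_mul_of_nonneg_left h1 (by positivity)
  have h5 : q ^ 2 / κ = κ * s ^ 2 / 4 := by rw [hqs]; field_simp; ring
  have h6 : s * (κ * a + q) ≤ s * ε := mul_le_mul_of_nonneg_left hε hs0
  have h7 : s * ρ * a ≤ s * (κ * a) := by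
    have : ρ * a ≤ κ * a := mul_le_mul_of_nonneg_right (by linarith) ha
    nlinarith
  rw [h5]
  rw [hqs] at h6
  nlinarith

theorem one_half_le_one_sub_exp_neg_one : 1 / 2 ≤ 1 - Real.exp (-1) := by
  have h := Real.exp_neg_le_quadratic zero_le_one
  norm_num at h ⊢
  linarith

/-- `2ρ` is the harmonic mean of two numbers, each at most `1 - 1/e`. -/
theorem approximationRatio_le {α δ : ℝ} (hα₀ : 0 ≤ α) (hα₁ : α ≤ 1) (hδ₀ : 0 < δ)
    (hδ₁ : δ < 1 / 2) :
    2 * ((1 - Real.exp (-α)) * (1 / 2 - δ) / ((1 - Real.exp (-α)) + (1 / 2 - δ))) ≤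
      1 - Real.exp (-1) := by
  have h1 := one_half_le_one_sub_exp_neg_one
  have h2 : Real.exp (-1) ≤ Real.exp (-α) := Real.exp_le_exp.2 (by linarith)
  have h3 : Real.exp (-α) ≤ 1 := Real.exp_le_one_iff.2 (by linarith)
  set x := 1 - Real.exp (-α)
  set κ := 1 - Real.exp (-1)
  have hx : x ≤ κ := by simp only [x, κ]; linarith
  have hx0 : 0 ≤ x := by simp only [x]; linarith
  rw [← mul_div_assoc, div_le_iff₀ (by linarith)]
  nlinarith [mul_nonneg hx0 (by linarith : 0 ≤ κ - 1 / 2), mul_nonneg hx0 hδ₀.le,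
    mul_nonneg (sub_nonneg.2 hx) (by linarith : 0 ≤ 1 / 2 - δ)]

section PartitionExpectation

variable {V : Type*} [Fintype V] [DecidableEq V] {m : ℕ}

theorem partitionExpectation_mono {f g : (V → Fin m) → ℝ} (h : ∀ P, f P ≤ g P) :
    partitionExpectation f ≤ partitionExpectation g :=
  div_le_div_of_nonneg_right (Finset.sum_le_sum fun P _ => h P) (by positivity)

theorem partitionExpectation_const_mul (c : ℝ) (f : (V → Fin m) → ℝ) :
    partitionExpectation (fun P => c * f P) = c * partitionExpectation f := by
  rw [partitionExpectation, partitionExpectation, ← Finset.mul_sum, mul_div_assoc]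

theorem partitionExpectation_mul_add_const (hm : 1 ≤ m) (c d : ℝ) (f : (V → Fin m) → ℝ) :
    partitionExpectation (fun P => c * f P + d) = c * partitionExpectation f + d := by
  have hm' : (m : ℝ) ≠ 0 := by exact_mod_cast (by omega : m ≠ 0)
  have h : (m : ℝ) ^ Fintype.card V ≠ 0 := pow_ne_zero _ hm'
  rw [partitionExpectation, partitionExpectation, Finset.sum_add_distrib, ← Finset.mul_sum,
    add_div, mul_div_assoc]
  congr 1
  simp [h]

theorem partitionExpectation_nonneg {f : (V → Fin m) → ℝ} (h : ∀ P, 0 ≤ f P) :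
    0 ≤ partitionExpectation f :=
  div_nonneg (Finset.sum_nonneg fun P _ => h P) (by positivity)

end PartitionExpectation

/-! ### Concentration and transfer to influence -/

namespace Network

section Guarantee

variable {V : Type*} [Fintype V] [DecidableEq V] [Nonempty V]

/-- A union bound kept as an exponential moment rather than an event, so that it serves both the
expectation and the tail. -/
theorem sum_samplesProb_mul_sum_exp_le {G : Network V} (hG : G.Valid) (θ : ℕ)
    (𝒮 : Finset (Finset V)) (s c : ℝ) :
    ∑ R : Fin θ → Finset V, G.samplesProb R * ∑ S ∈ 𝒮,
      Real.exp (s * GreediRIS.coverage R S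
        - (θ * (G.influence S / Fintype.card V) * (Real.exp s - 1) + c)) ≤
      𝒮.card * Real.exp (-c) := by
  simp only [Finset.mul_sum]
  rw [Finset.sum_comm, ← nsmul_eq_mul]
  refine Finset.sum_le_card_nsmul _ _ _ fun S _ => ?_
  have h := sum_samplesProb_mul_exp_coverage_le hG (θ := θ) S s
  set Y := θ * (G.influence S / Fintype.card V) * (Real.exp s - 1)
  calc _ = (∑ R : Fin θ → Finset V, G.samplesProb R * Real.exp (s * GreediRIS.coverage R S))
        * Real.exp (-(Y + c)) := by
        rw [Finset.sum_mul]
        refine Finset.sum_congr rfl fun R _ => ?_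
        rw [mul_assoc, ← Real.exp_add, sub_eq_add_neg]
    _ ≤ Real.exp Y * Real.exp (-(Y + c)) :=
        mul_le_mul_of_nonneg_right h (Real.exp_pos _).le
    _ = _ := by
        rw [← Real.exp_add]
        ring_nf

/-- Lower tail bound for the coverage of `S`. -/
theorem sum_samplesProb_mul_exp_lower_le {G : Network V} (hG : G.Valid) (θ : ℕ) (S : Finset V)
    {L a : ℝ} (hL : 0 < L) (ha : 0 ≤ a)
    (hX : θ * (G.influence S / Fintype.card V) = 2 * L ^ 2) :
    ∑ R : Fin θ → Finset V, G.samplesProb R *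
      Real.exp (a / L * (2 * L ^ 2 - 2 * L * a - GreediRIS.coverage R S)) ≤
      Real.exp (-a ^ 2) := by
  have h := sum_samplesProb_mul_exp_coverage_le hG (θ := θ) S (-(a / L))
  rw [hX] at h
  have hq := Real.exp_neg_le_quadratic (div_nonneg ha hL.le)
  calc _ = (∑ R : Fin θ → Finset V,
        G.samplesProb R * Real.exp (-(a / L) * GreediRIS.coverage R S))
        * Real.exp (a / L * (2 * L ^ 2 - 2 * L * a)) := by
        rw [Finset.sum_mul]
        refine Finset.sum_congr rfl fun R _ => ?_
        rw [mul_assoc (G.samplesProb R), ← Real.exp_add]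
        ring_nf
    _ ≤ Real.exp (2 * L ^ 2 * (Real.exp (-(a / L)) - 1))
        * Real.exp (a / L * (2 * L ^ 2 - 2 * L * a)) :=
        mul_le_mul_of_nonneg_right h (Real.exp_pos _).le
    _ ≤ _ := by
        rw [← Real.exp_add]
        refine Real.exp_le_exp.2 ?_
        have h1 := mul_le_mul_of_nonneg_left hq (by positivity : 0 ≤ 2 * L ^ 2)
        have h2 : 2 * L ^ 2 * (1 - a / L + (a / L) ^ 2 / 2) =
            2 * L ^ 2 - 2 * L * a + a ^ 2 := by
          field_simp
        have h3 : a / L * (2 * L ^ 2 - 2 * L * a) = 2 * L * a - 2 * a ^ 2 := by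
          field_simp
        rw [h2] at h1
        rw [h3]
        linarith

/-- If the selected seed sets achieve, on average over the assignments, a fraction `ρ` of the
maximum coverage, then they achieve the fraction `ρ - ε` of the maximum influence. -/
theorem influence_guarantee_of_coverage {G : Network V} (hG : G.Valid) {k m θ : ℕ}
    (hk : 1 ≤ k) (hm : 1 ≤ m) {ε η ρ : ℝ} (hε : 0 < ε) (hη₀ : 0 < η) (hη₁ : η < 1)
    (hρ₀ : 0 ≤ ρ) (hρ : 2 * ρ ≤ 1 - Real.exp (-1))
    (hθ : lambdaStar (Fintype.card V) k ε η / G.opt k ≤ θ)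
    (T : (Fin θ → Finset V) → (V → Fin m) → Finset V) (hT : ∀ R P, (T R P).card ≤ k)
    (hcov : ∀ R, ∀ O : Finset V, O.card ≤ k → ρ * GreediRIS.coverage R O ≤
      partitionExpectation fun P => (GreediRIS.coverage R (T R P) : ℝ)) :
    (ρ - ε) * G.opt k ≤ ∑ R : Fin θ → Finset V,
        G.samplesProb R * partitionExpectation (fun P => G.influence (T R P)) ∧
    1 - η ≤ ∑ R : Fin θ → Finset V with
          (ρ - ε) * G.opt k ≤ partitionExpectation (fun P => G.influence (T R P)),
        G.samplesProb R := by
  have hOPT := opt_pos hG hk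
  have hσ0 : ∀ S, 0 ≤ G.influence S := fun S =>
    (Nat.cast_nonneg _).trans (card_le_influence hG S)
  have hE0 : ∀ R, 0 ≤ partitionExpectation (fun P => G.influence (T R P)) := fun R =>
    partitionExpectation_nonneg fun P => hσ0 _
  -- For `ρ < ε` the target is negative. Otherwise `ε ≤ ρ` keeps the exponent `s` below at most `1`.
  rcases lt_or_ge ρ ε with hlt | hr
  · have hneg : (ρ - ε) * G.opt k ≤ 0 :=
      mul_nonpos_of_nonpos_of_nonneg (by linarith) hOPT.le
    refine ⟨hneg.trans (Finset.sum_nonneg fun R _ =>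
      mul_nonneg (samplesProb_nonneg hG R) (hE0 R)), ?_⟩
    rw [Finset.filter_true_of_mem fun R _ => hneg.trans (hE0 R), sum_samplesProb]
    linarith
  set n := Fintype.card V with hn
  have hn0 : (0 : ℝ) < n := by exact_mod_cast Fintype.card_pos
  set N : ℕ := n.choose (min k (n / 2)) with hN
  have hN1 : (1 : ℝ) ≤ N := by
    have : 0 < N := Nat.choose_pos ((min_le_right _ _).trans (Nat.div_le_self _ _))
    exact_mod_cast this
  set κ : ℝ := 1 - Real.exp (-1) with hκdef
  have hκ : 0 < κ := by linarith [one_half_le_one_sub_exp_neg_one]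
  set ℓ := Real.log (2 / η) with hℓ
  have hη2 : 2 ≤ 2 / η := by rw [le_div_iff₀ hη₀]; linarith
  have hηη : η ^ 2 ≤ η := pow_le_of_le_one hη₀.le hη₁.le two_ne_zero
  have hℓ0 : 0 < ℓ := Real.log_pos (by linarith)
  set Q := Real.log N + ℓ with hQ
  have hQ0 : 0 < Q := by
    have := Real.log_nonneg hN1
    linarith
  set a := √ℓ with ha
  have ha0 : 0 ≤ a := Real.sqrt_nonneg _
  have ha2 : a ^ 2 = ℓ := Real.sq_sqrt hℓ0.le
  set b := √(κ * Q) with hb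
  have hb0 : 0 < b := Real.sqrt_pos.2 (by positivity)
  have hb2 : b ^ 2 = κ * Q := Real.sq_sqrt (by positivity)
  obtain ⟨O, hOk, hO⟩ := G.exists_influence_eq_opt k
  -- `X` is the mean coverage of an optimal `O`. Writing `X = 2L²` makes a deviation of `2La` cost
  -- exactly `e^{-a²} = η/2`.
  set X : ℝ := θ * (G.influence O / n) with hX
  set L := √(X / 2) with hL
  have hbound : 2 * (κ * a + b) ^ 2 ≤ ε ^ 2 * X := by
    have h1 : lambdaStar n k ε η = 2 * n * (κ * a + b) ^ 2 / ε ^ 2 := rfl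
    rw [h1, div_div, div_le_iff₀ (by positivity)] at hθ
    rw [hX, hO]
    have h2 : ε ^ 2 * (θ * (G.opt k / n)) = θ * (ε ^ 2 * G.opt k) / n := by ring
    rw [h2, le_div_iff₀ hn0]
    linarith
  have hX0 : 0 < X := by
    have : 0 < ε ^ 2 * X := lt_of_lt_of_le (by positivity) hbound
    exact pos_of_mul_pos_right this (by positivity)
  have hL0 : 0 < L := Real.sqrt_pos.2 (by positivity)
  have hL2 : X = 2 * L ^ 2 := by
    rw [hL, Real.sq_sqrt (by positivity)]
    ring
  have hεL : κ * (a / L) + b / L ≤ ε := by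
    have h1 : κ * (a / L) + b / L = (κ * a + b) / L := by ring
    rw [h1, div_le_iff₀ hL0]
    refine le_of_sq_le_sq ?_ (by positivity)
    rw [mul_pow]
    rw [hL2] at hbound
    linarith only [hbound]
  -- With this exponent the quadratic term of the numerical inequality, times `X`, is `2Q`, the
  -- price of the union bound.
  set s := 2 * (b / L) / κ with hs
  have hs0 : 0 < s := by positivity
  have hexp : 0 < Real.exp s - 1 := by
    have := Real.add_one_lt_exp hs0.ne'
    linarith
  have hQL : X * ((b / L) ^ 2 / κ) = 2 * Q := by
    rw [hL2, div_pow, hb2]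
    field_simp
  have hnum : X * ((ρ - ε) * (Real.exp s - 1)) ≤ s * (ρ * (X - 2 * L * a)) - 2 * Q := by
    have h1 := mul_le_mul_of_nonneg_left (sub_mul_exp_sub_one_le hκ (div_nonneg ha0 hL0.le)
      (div_nonneg hb0.le hL0.le) hεL hρ hr) hX0.le
    rw [← hs, mul_sub X, hQL] at h1
    refine h1.trans (le_of_eq ?_)
    congr 1
    rw [hL2]
    field_simp
  have hconv : ∀ e : ℝ, X * ((ρ - ε) * (Real.exp s - 1)) ≤ θ / n * e * (Real.exp s - 1) →
      (ρ - ε) * G.opt k ≤ e := by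
    intro e he
    have h1 : X * ((ρ - ε) * (Real.exp s - 1)) =
        θ / n * (Real.exp s - 1) * ((ρ - ε) * G.opt k) := by
      rw [hX, hO]
      ring
    have hθ0 : (0 : ℝ) < θ := by
      rcases (Nat.cast_nonneg (α := ℝ) θ).lt_or_eq with h | h
      · exact h
      · rw [hX, ← h] at hX0
        simp at hX0
    rw [h1, mul_right_comm] at he
    refine le_of_mul_le_mul_left ?_ (by positivity : 0 < θ / n * (Real.exp s - 1))
    linarith
  set 𝒮 := Finset.univ.filter fun S : Finset V => S.card ≤ k with h𝒮
  -- At most `2N²` sets against `e^{-2Q} = (η / (2N))²`.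
  have h𝒮exp : 𝒮.card * Real.exp (-(2 * Q)) ≤ η ^ 2 / 2 := by
    have hcard : (𝒮.card : ℝ) ≤ 2 * (N : ℝ) ^ 2 := by
      exact_mod_cast card_filter_card_le_le hk
    have h1 : Real.exp (-(2 * Q)) = ((N : ℝ) * (2 / η))⁻¹ ^ 2 := by
      rw [hQ, hℓ, ← Real.log_mul (by positivity) (by positivity), ← mul_neg, mul_comm,
        Real.exp_mul, Real.exp_neg, Real.exp_log (by positivity)]
      norm_cast
    rw [h1]
    calc _ ≤ 2 * (N : ℝ) ^ 2 * ((N : ℝ) * (2 / η))⁻¹ ^ 2 :=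
          mul_le_mul_of_nonneg_right hcard (by positivity)
      _ = _ := by
        field_simp
  set Z : (Fin θ → Finset V) → ℝ := fun R => ∑ S ∈ 𝒮, Real.exp (s * GreediRIS.coverage R S
        - (θ * (G.influence S / n) * (Real.exp s - 1) + 2 * Q)) with hZ
  have hZsum : ∑ R, G.samplesProb R * Z R ≤ η ^ 2 / 2 :=
    (sum_samplesProb_mul_sum_exp_le hG θ 𝒮 s (2 * Q)).trans h𝒮exp
  have hZmem : ∀ R, ∀ S ∈ 𝒮, Real.exp (s * GreediRIS.coverage R S
      - (θ * (G.influence S / n) * (Real.exp s - 1) + 2 * Q)) ≤ Z R := fun R S hS =>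
    Finset.single_le_sum (f := fun S => Real.exp (s * GreediRIS.coverage R S
      - (θ * (G.influence S / n) * (Real.exp s - 1) + 2 * Q)))
      (fun _ _ => (Real.exp_pos _).le) hS
  have hTS : ∀ R P, T R P ∈ 𝒮 := fun R P => by simpa [h𝒮] using hT R P
  -- The bound is affine in the influence, so it survives averaging over the assignment, where
  -- `hcov` applies.
  have haverage : ∀ R z, (∀ P, s * GreediRIS.coverage R (T R P) ≤
      θ * (G.influence (T R P) / n) * (Real.exp s - 1) + 2 * Q + z) →
      s * (ρ * GreediRIS.coverage R O) ≤ θ / n *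
        partitionExpectation (fun P => G.influence (T R P)) * (Real.exp s - 1) + 2 * Q + z := by
    intro R z h
    have h1 := mul_le_mul_of_nonneg_left (hcov R O hOk) hs0.le
    rw [← partitionExpectation_const_mul] at h1
    refine h1.trans ((partitionExpectation_mono h).trans (le_of_eq ?_))
    have h2 : (fun P => θ * (G.influence (T R P) / n) * (Real.exp s - 1) + 2 * Q + z) =
        fun P => θ / n * (Real.exp s - 1) * G.influence (T R P) + (2 * Q + z) := by
      ext P
      ring
    rw [h2, partitionExpectation_mul_add_const hm]
    ring
  constructor
  · refine hconv _ ?_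
    have hR : ∀ R, s * (ρ * GreediRIS.coverage R O) ≤ θ / n *
        partitionExpectation (fun P => G.influence (T R P)) * (Real.exp s - 1) + 2 * Q
          + (Z R - 1) := by
      intro R
      refine haverage R _ fun P => ?_
      have h1 := hZmem R _ (hTS R P)
      -- From `t + 1 ≤ e^t ≤ Z R`, the error is at most `Z R - 1`, whose mean is negative; no
      -- failure event has to be split off.
      have h2 := Real.add_one_le_exp (s * GreediRIS.coverage R (T R P)
        - (θ * (G.influence (T R P) / n) * (Real.exp s - 1) + 2 * Q))
      linarith
    have hsum := Finset.sum_le_sum fun R (_ : R ∈ Finset.univ) =>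
      mul_le_mul_of_nonneg_left (hR R) (samplesProb_nonneg hG R)
    have hl : ∑ R : Fin θ → Finset V, G.samplesProb R * (s * (ρ * GreediRIS.coverage R O)) =
        s * (ρ * X) := by
      rw [hX, ← sum_samplesProb_mul_coverage hG O, Finset.mul_sum, Finset.mul_sum]
      exact Finset.sum_congr rfl fun R _ => by ring
    have hrhs : ∑ R : Fin θ → Finset V, G.samplesProb R * (θ / n *
        partitionExpectation (fun P => G.influence (T R P)) * (Real.exp s - 1) + 2 * Q
          + (Z R - 1)) = θ / n * (∑ R : Fin θ → Finset V, G.samplesProb R *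
            partitionExpectation (fun P => G.influence (T R P))) * (Real.exp s - 1)
          + (2 * Q - 1) + ∑ R, G.samplesProb R * Z R := by
      have h1 : (2 * Q - 1) = ∑ R : Fin θ → Finset V, G.samplesProb R * (2 * Q - 1) := by
        rw [← Finset.sum_mul, sum_samplesProb, one_mul]
      rw [h1, Finset.mul_sum, Finset.sum_mul, ← Finset.sum_add_distrib, ← Finset.sum_add_distrib]
      exact Finset.sum_congr rfl fun R _ => by ring
    rw [hl, hrhs] at hsum
    -- The mean of `C(O)` is exactly `X`, so the allowance `2La` for its lower tail is simply
    -- dropped.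
    have hpos : 0 ≤ s * (ρ * (2 * L * a)) := by positivity
    rw [mul_sub ρ, mul_sub s] at hnum
    linarith only [hsum, hnum, hZsum, hpos, hηη, hη₁]
  -- Markov's inequality: on a bad sample family one of the exponentials is at least `1`. Their
  -- means add up to at most `η²/2 + η/2 ≤ η`.
  · have hgood : ∀ R : Fin θ → Finset V,
        ¬ (ρ - ε) * G.opt k ≤ partitionExpectation (fun P => G.influence (T R P)) →
        1 ≤ Z R + Real.exp (a / L * (2 * L ^ 2 - 2 * L * a - GreediRIS.coverage R O)) := by
      intro R hbad
      by_contra hlt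
      push Not at hlt
      have hZ0 : 0 ≤ Z R := Finset.sum_nonneg fun S _ => (Real.exp_pos _).le
      have hc : X - 2 * L * a ≤ GreediRIS.coverage R O := by
        by_contra hc
        push Not at hc
        have : 1 ≤ Real.exp (a / L * (2 * L ^ 2 - 2 * L * a - GreediRIS.coverage R O)) := by
          refine Real.one_le_exp (mul_nonneg (by positivity) ?_)
          linarith
        linarith
      refine hbad (hconv _ ?_)
      have h1 := haverage R 0 fun P => by
        by_contra h
        push Not at h
        have h1 := hZmem R _ (hTS R P)
        have h2 : 1 ≤ Real.exp (s * GreediRIS.coverage R (T R P)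
            - (θ * (G.influence (T R P) / n) * (Real.exp s - 1) + 2 * Q)) :=
          Real.one_le_exp (by linarith)
        have h3 := Real.exp_pos (a / L * (2 * L ^ 2 - 2 * L * a - GreediRIS.coverage R O))
        linarith
      have h2 := mul_le_mul_of_nonneg_left (mul_le_mul_of_nonneg_left hc hρ₀) hs0.le
      linarith
    have hlower := sum_samplesProb_mul_exp_lower_le hG θ O hL0 ha0 (hX.symm.trans hL2)
    have hexpa : Real.exp (-a ^ 2) = η / 2 := by
      rw [ha2, hℓ, Real.exp_neg, Real.exp_log (by positivity), inv_div]
    rw [hexpa] at hlower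
    have hsplit := Finset.sum_filter_add_sum_filter_not Finset.univ
      (fun R => (ρ - ε) * G.opt k ≤ partitionExpectation (fun P => G.influence (T R P)))
      fun R : Fin θ → Finset V => G.samplesProb R
    rw [sum_samplesProb] at hsplit
    have hbadsum : ∑ R : Fin θ → Finset V with
          ¬ (ρ - ε) * G.opt k ≤ partitionExpectation (fun P => G.influence (T R P)),
        G.samplesProb R ≤ ∑ R : Fin θ → Finset V, G.samplesProb R *
          (Z R + Real.exp (a / L * (2 * L ^ 2 - 2 * L * a - GreediRIS.coverage R O))) := by
      have hterm : ∀ R : Fin θ → Finset V, 0 ≤ G.samplesProb R *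
          (Z R + Real.exp (a / L * (2 * L ^ 2 - 2 * L * a - GreediRIS.coverage R O))) :=
        fun R => mul_nonneg (samplesProb_nonneg hG R)
          (add_nonneg (Finset.sum_nonneg fun S _ => (Real.exp_pos _).le) (Real.exp_pos _).le)
      refine le_trans (Finset.sum_le_sum fun R hR => ?_)
        (Finset.sum_le_sum_of_subset_of_nonneg (Finset.filter_subset _ _) fun R _ _ => hterm R)
      exact le_mul_of_one_le_right (samplesProb_nonneg hG R)
        (hgood R (Finset.mem_filter.1 hR).2)
    simp only [mul_add, Finset.sum_add_distrib] at hbadsum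
    linarith only [hsplit, hbadsum, hZsum, hlower, hηη]

end Guarantee

end Network

theorem mainTheorem3 {V : Type*} [Fintype V] [LinearOrder V] [Nonempty V]
    (G : Network V) (hG : G.Valid)
    (k m θ : ℕ) (hk : 1 ≤ k) (hm : 1 ≤ m)
    (α δ ε η : ℝ) (hα₀ : 0 ≤ α) (hα₁ : α ≤ 1) (hδ₀ : 0 < δ) (hδ₁ : δ < 1 / 2) (hε : 0 < ε)
    (hη₀ : 0 < η) (hη₁ : η < 1)
    (hθ : lambdaStar (Fintype.card V) k ε η / G.opt k ≤ θ)
    (stream : (Fin θ → Finset V) → (V → Fin m) → List V)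
    (hstream : ∀ R P, (stream R P).Perm (GreediRIS.sentSeeds R k α P))
    (l u : (Fin θ → Finset V) → (V → Fin m) → ℝ)
    (hlu : ∀ R P, 0 < GreediRIS.optCoverage R k (stream R P).toFinset →
      0 < l R P ∧ l R P ≤ GreediRIS.optCoverage R k (stream R P).toFinset ∧
        (GreediRIS.optCoverage R k (stream R P).toFinset : ℝ) ≤ u R P) :
    let S : (Fin θ → Finset V) → (V → Fin m) → Finset V := fun R P =>
      GreediRIS.output R k δ (l R P) (u R P) P (stream R P)
    let ρ : ℝ := (1 - Real.exp (-α)) * (1 / 2 - δ) / ((1 - Real.exp (-α)) + (1 / 2 - δ))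
    (∀ R P, (S R P).card ≤ k) ∧
    (ρ - ε) * G.opt k ≤
      ∑ R : Fin θ → Finset V,
        G.samplesProb R * partitionExpectation (fun P => G.influence (S R P)) ∧
    1 - η ≤
      ∑ R : Fin θ → Finset V with
          (ρ - ε) * G.opt k ≤ partitionExpectation (fun P => G.influence (S R P)),
        G.samplesProb R := by
  intro S ρ
  have hx : 0 ≤ 1 - Real.exp (-α) := by
    have := Real.exp_le_one_iff.2 (neg_nonpos.2 hα₀)
    linarith
  have hy : 0 < 1 / 2 - δ := by linarith
  refine ⟨fun R P => GreediRIS.card_output_le _ _ _ _ _ _ _, ?_⟩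
  exact Network.influence_guarantee_of_coverage hG hk hm hε hη₀ hη₁ (by positivity)
    (approximationRatio_le hα₀ hα₁ hδ₀ hδ₁) hθ S
    (fun R P => GreediRIS.card_output_le _ _ _ _ _ _ _)
    fun R O hO => GreediRIS.coverage_le_partitionExpectation_output R hk hm hα₀ hα₁ hδ₀ hδ₁
      (stream R) (hstream R) (l R) (u R) (hlu R) hO
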